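/- Let $n\ge 0$ and let $f$ be a homogeneous real polynomial of degree $4$ on $\mathbb{R}^n$ satisfying the eikonal equation $|\nabla f(x)|^2=16|x|^6$ for all $x$. Two functions $F,G$ on $\mathbb{R}^n$ are called congruent if $G(x)=F(Ux)$ for all $x$, or $G(x)=-F(Ux)$ for all $x$, for some orthogonal transformation $U$. Call $f$ primitive if it is congruent to $$h_{4,H}(x)=|\xi|^4-6|\xi|^2|\eta|^2+|\eta|^4$$ for some linear subspace $H\subseteq\mathbb{R}^n$, where $\xi$ and $\eta$ are the orthogonal projections of $x$ onto $H$ and $H^\perp$. Call $f$ isoparametric with multiplicities $(m_1,m_2)$, where $m_1,m_2$ are positive integers with $n=2(m_1+m_2)+2$, if it satisfies both Münzner–Cartan equations $$|\nabla f|^2=16|x|^6,\qquad \Delta f=\frac{m_2-m_1}{2}\,4^2|x|^2,$$ and for every $c\in(-1,1)$ the level set $\{|x|=1,\ f(x)=c\}$ is a nonempty regular hypersurface of the unit sphere which, with respect to the unit normal in the direction of increasing $f$, has exactly four distinct principal curvatures $\kappa_0>\kappa_1>\kappa_2>\kappa_3$, constant on the level set, of multiplicities $m_1,m_2,m_1,m_2$.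 Call $f$ isoparametric if this holds for some $m_1,m_2$. Then: 1. $f$ is isoparametric or primitive. 2. $f$ is primitive if and only if, for some integer $0\le k\le[n/2]$, it is congruent to $$\Big(\sum_{i=1}^n x_i^2\Big)^2-8\Big(\sum_{i=1}^k x_i^2\Big)\Big(\sum_{i=k+1}^n x_i^2\Big).$$ 3. If $f$ is not primitive, there are integers $p\ge 0$, $q\ge2$, $\nu\ge1$ such that $f$ is isoparametric with multiplicities $m_1=q-1$ and $m_2=\nu$, and such that for every maximum point $e$ of $f$ on the unit sphere the following holds. There are an orthogonal decomposition $e^\perp=L\oplus M$ with $\dim L=p$, $\dim M=q$, and symmetric endomorphisms $A_\eta$ of $L$, depending linearly on $\eta\in M$, with $$f(se+\xi+\eta)=s^4+2(|\xi|^2-3|\eta|^2)s^2+8\langle A_\eta\xi,\xi\rangle s+f(\xi+\eta)\qquad(s\in\mathbb{R},\ \xi\in L,\ \eta\in M),$$ and for $\eta\ne0$ the eigenvalues of $A_\eta$ are $|\eta|$, $-|\eta|$ and $0$, with multiplicities $\nu$, $\nu$ and $p-2\nu$. -/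

import Mathlib

open scoped Gradient

/-- The Euclidean space `ℝⁿ` with its standard scalar product. -/
abbrev Euc (n : ℕ) : Type := EuclideanSpace ℝ (Fin n)

/-- The function on `ℝⁿ` given by a polynomial in `n` variables. -/
noncomputable def polyFun {n : ℕ} (f : MvPolynomial (Fin n) ℝ) : Euc n → ℝ :=
  fun x => MvPolynomial.eval (fun i => x i) f

/-- A quartic eikonal polynomial: homogeneous of degree `4` with `|∇f|² = 16 |x|⁶`. -/
def IsEikonalQuartic {n : ℕ} (f : MvPolynomial (Fin n) ℝ) : Prop :=
  f.IsHomogeneous 4 ∧ ∀ x : Euc n, ‖∇ (polyFun f) x‖ ^ 2 = 16 * ‖x‖ ^ 6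

/-- Two functions are congruent if they agree up to an orthogonal transformation and a sign. -/
def CongruentFun {n : ℕ} (F G : Euc n → ℝ) : Prop :=
  ∃ U : Euc n ≃ₗᵢ[ℝ] Euc n, (∀ x, G x = F (U x)) ∨ (∀ x, G x = -F (U x))

/-- `h_{4,H} = |ξ|⁴ - 6 |ξ|² |η|² + |η|⁴`, where `ξ`, `η` are the orthogonal projections of `x`
onto `H` and `Hᗮ`. -/
noncomputable def primitiveForm {n : ℕ} (H : Submodule ℝ (Euc n)) (x : Euc n) : ℝ :=
  ‖H.starProjection x‖ ^ 4 - 6 * ‖H.starProjection x‖ ^ 2 * ‖Hᗮ.starProjection x‖ ^ 2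
    + ‖Hᗮ.starProjection x‖ ^ 4

/-- A primitive quartic: congruent to some `h_{4,H}` (`H` may be `0` or the whole space). -/
def IsPrimitiveQuartic {n : ℕ} (f : MvPolynomial (Fin n) ℝ) : Prop :=
  ∃ H : Submodule ℝ (Euc n), CongruentFun (primitiveForm H) (polyFun f)

/-- `(∑ᵢ xᵢ²)² - 8 (∑_{i ≤ k} xᵢ²) (∑_{i > k} xᵢ²)`; indices in `Fin n` start at `0`. -/
def standardQuartic (n k : ℕ) (x : Euc n) : ℝ :=
  (∑ i, x i ^ 2) ^ 2
    - 8 * (∑ i with i.val < k, x i ^ 2) * (∑ i with k ≤ i.val, x i ^ 2)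

/-- The level set `{|x| = 1, F x = c}` in the unit sphere. -/
def sphereLevel {n : ℕ} (F : Euc n → ℝ) (c : ℝ) : Set (Euc n) :=
  {x | ‖x‖ = 1 ∧ F x = c}

/-- At a point of the unit sphere, the gradient of the restriction of `F` to the sphere. -/
noncomputable def sphereGrad {n : ℕ} (F : Euc n → ℝ) (x : Euc n) : Euc n :=
  ∇ F x - inner ℝ x (∇ F x) • x

/-- The unit normal, inside the unit sphere, of the level hypersurfaces of `F`, pointing in the
direction in which `F` increases. -/
noncomputable def unitNormal {n : ℕ} (F : Euc n → ℝ) (x : Euc n) : Euc n :=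
  ‖sphereGrad F x‖⁻¹ • sphereGrad F x

/-- The tangent space at `x` of the level hypersurface of `F` in the unit sphere: the vectors
orthogonal to the position vector and to the normal. -/
noncomputable def levelTangent {n : ℕ} (F : Euc n → ℝ) (x : Euc n) : Submodule ℝ (Euc n) :=
  (Submodule.span ℝ {x, unitNormal F x})ᗮ

/-- The space of principal directions with principal curvature `κ` of the level hypersurface
through `x`, that is, the tangent vectors `v` with `- D_v N = κ v`, `N` the unit normal. -/
noncomputable def principalSpace {n : ℕ} (F : Euc n → ℝ) (x : Euc n) (κ : ℝ) :
    Submodule ℝ (Euc n) :=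
  levelTangent F x ⊓ Module.End.eigenspace (-(fderiv ℝ (unitNormal F) x).toLinearMap) κ

/-- `f` is the isoparametric quartic of a family of hypersurfaces of the unit sphere with four
distinct principal curvatures, whose largest and smallest principal curvatures have
multiplicities `m₁` and `m₂`: it satisfies both Münzner–Cartan equations, and every
`{f = c}`, `-1 < c < 1`, is a nonempty hypersurface of the sphere (with the gradient nowhere zero)
whose principal curvatures are constants `κ₀ > κ₁ > κ₂ > κ₃` of multiplicities
`m₁, m₂, m₁, m₂`. -/
structure IsIsoparametricWith {n : ℕ} (f : MvPolynomial (Fin n) ℝ) (m₁ m₂ : ℕ) : Prop where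
  eikonal : IsEikonalQuartic f
  laplace : ∀ x : Euc n,
    Laplacian.laplacian (polyFun f) x = ((m₂ : ℝ) - (m₁ : ℝ)) / 2 * 4 ^ 2 * ‖x‖ ^ 2
  pos₁ : 0 < m₁
  pos₂ : 0 < m₂
  dim_eq : n = 2 * (m₁ + m₂) + 2
  nonempty : ∀ c ∈ Set.Ioo (-1 : ℝ) 1, (sphereLevel (polyFun f) c).Nonempty
  regular : ∀ c ∈ Set.Ioo (-1 : ℝ) 1, ∀ x ∈ sphereLevel (polyFun f) c,
    sphereGrad (polyFun f) x ≠ 0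
  curvatures : ∀ c ∈ Set.Ioo (-1 : ℝ) 1, ∃ κ : Fin 4 → ℝ, StrictAnti κ ∧
    ∀ x ∈ sphereLevel (polyFun f) c, ∀ i : Fin 4,
      Module.finrank ℝ (principalSpace (polyFun f) x (κ i)) = if Even i.val then m₁ else m₂

/-- `f` is an isoparametric quartic. -/
def IsIsoparametricQuartic {n : ℕ} (f : MvPolynomial (Fin n) ℝ) : Prop :=
  ∃ m₁ m₂ : ℕ, IsIsoparametricWith f m₁ m₂

/-- `f` has a normal form of type `(p, q, ν)` along the unit vector `e`: there are an orthogonal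
decomposition `eᗮ = L ⊕ M` with `dim L = p`, `dim M = q`, and symmetric endomorphisms `A_η` of `L`
depending linearly on `η ∈ M`, with
`f(s e + ξ + η) = s⁴ + 2 (|ξ|² - 3 |η|²) s² + 8 ⟨A_η ξ, ξ⟩ s + f(ξ + η)`, where for `η ≠ 0` the
eigenvalues of `A_η` are `|η|`, `-|η|`, `0` with multiplicities `ν`, `ν`, `p - 2ν`. -/
def HasNormalForm {n : ℕ} (f : MvPolynomial (Fin n) ℝ) (e : Euc n) (p q ν : ℕ) : Prop :=
  ∃ (L M : Submodule ℝ (Euc n)) (A : M →ₗ[ℝ] (L →ₗ[ℝ] L)),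
    L ⟂ M ∧ L ⊔ M = (Submodule.span ℝ {e})ᗮ ∧
    Module.finrank ℝ L = p ∧ Module.finrank ℝ M = q ∧
    (∀ η, (A η).IsSymmetric) ∧
    (∀ (s : ℝ) (ξ : L) (η : M),
      polyFun f (s • e + (ξ : Euc n) + (η : Euc n)) =
        s ^ 4 + 2 * (‖ξ‖ ^ 2 - 3 * ‖η‖ ^ 2) * s ^ 2 + 8 * inner ℝ (A η ξ) ξ * s
          + polyFun f ((ξ : Euc n) + (η : Euc n))) ∧
    ∀ η : M, η ≠ 0 →
      Module.finrank ℝ (Module.End.eigenspace (A η) ‖η‖) = ν ∧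
      Module.finrank ℝ (Module.End.eigenspace (A η) (-‖η‖)) = ν ∧
      Module.finrank ℝ (Module.End.eigenspace (A η) 0) + 2 * ν = p

/-!
The quartic `f` is written as `f x = ⟪G x x x, x⟫` with a symmetric trilinear map `G`, and the
eikonal equation becomes `|G x x x|² = |x|⁶`. Its polarisations (`IsEikonalForm.polarised`) are the
only analytic input; the rest is linear algebra and two continuity arguments.

By Cauchy-Schwarz `|f| ≤ 1` on the unit sphere, and `f e = 1` exactly when `G e e e = e`; such
points are called focal here. At a focal point the polarised identities show that `G e e` has the
eigenvalues `1/3` and `-1` on the orthogonal complement of `e`, with eigenspaces `L` and `M` (the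
tangent and the normal space of the set `{f = 1}`), that unit vectors of `M` are focal again, and
that the operators `A_η = (3/2) G e η` of `L` satisfy `A_η³ = |η|² A_η`
(`IsEikonalForm.shape_cube`). This is the normal form.

If all `A_η` vanish then `f = h_{4,M}`, and if `dim M = 1` and `A ≠ 0` then `A² = 1` and
`f = |x|⁴ - 2 ⟪R x, x⟫²` for a symmetric involution `R`, so that `f = -h_{4,H}`
(`IsEikonalForm.codim_and_shape_or_primitive`). If there are no focal points at all,
`f = -|x|⁴`. Hence for a quartic that is not primitive, `dim M ≥ 2` and `A ≠ 0` at all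
focal points, and `dim M ≥ 2` also for `-f`.

In that case the trace of `A_η` on the unit sphere of `M` is continuous, odd and integral, because
the eigenvalues are `0` and `±1`; so it is zero (`IsEikonalForm.trace_shape_eq_zero`). For a focal
point `e` and a unit vector `η ∈ M`, the midpoint of the great circle arc from `e` to `η` is focal
for `-f`, and the same fact there says that `f` has the same Laplacian at `e` and at `η`. Every
point of the sphere that is not focal for `f` or `-f` lies on such an arc, on which
`f = cos 4θ` (`IsEikonalForm.exists_focal`). So the Laplacian, suitably normalised, has integral
values on the connected unit sphere and is constant there (`IsRegularForm.trace_eq`). The dimension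
of `M` and the multiplicities of the eigenvalues of `A_η` are traces of projections that are
polynomials in the Hessians, and are therefore constant as well (`IsRegularForm.multiplicities`).

Finally, the principal directions of the level hypersurface at a point of an arc from `e` to `η` are
the eigenvectors of the Hessian orthogonal to the arc. These form `M ∩ ηᗮ` and the eigenspaces of
`A_η` for `-1`, `0` and `1`, with distinct eigenvalues that depend only on the angle
(`principalSpace_eq`).
-/

open scoped RealInnerProductSpace

/-! ### Polarised quartic eikonal forms -/

/-- The low coefficients of a sextic polynomial function that vanishes identically are zero. -/
theorem low_coeff_eq_zero_of_forall {a₀ a₁ a₂ a₃ a₄ a₅ a₆ : ℝ}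
    (h : ∀ t : ℝ,
      a₀ + a₁ * t + a₂ * t ^ 2 + a₃ * t ^ 3 + a₄ * t ^ 4 + a₅ * t ^ 5 + a₆ * t ^ 6 = 0) :
    a₁ = 0 ∧ a₂ = 0 ∧ a₃ = 0 := by
  have h0 := h 0
  have h1 := h 1
  have h2 := h (-1)
  have h3 := h 2
  have h4 := h (-2)
  have h5 := h 3
  have h6 := h (-3)
  norm_num at h0 h1 h2 h3 h4 h5 h6
  refine ⟨?_, ?_, ?_⟩ <;> linarith

theorem eq_of_inner_self {E : Type*} [NormedAddCommGroup E]
    [InnerProductSpace ℝ E] {u v : E} (h1 : ⟪u, u⟫ = ⟪v, v⟫) (h2 : ⟪u, v⟫ = ⟪v, v⟫) :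
    u = v := by
  rw [← sub_eq_zero, ← inner_self_eq_zero (𝕜 := ℝ)]
  simp only [inner_sub_left, inner_sub_right, real_inner_comm u v]
  linarith [real_inner_comm u v]

/-- A quartic form with `|∇f|² = 16 |x|⁶`, encoded by the symmetric trilinear map `G` with
`f x = ⟪G x x x, x⟫`: the four-linear form `⟪G x y z, w⟫` is symmetric, the gradient at `x` is
`4 G x x x`, and the Hessian is `12 G x x`. -/
structure IsEikonalForm {E : Type*} [NormedAddCommGroup E] [InnerProductSpace ℝ E]
    (G : E →ₗ[ℝ] E →ₗ[ℝ] E →ₗ[ℝ] E) : Prop where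
  swap₁₂ : ∀ x y z, G x y z = G y x z
  swap₂₃ : ∀ x y z, G x y z = G x z y
  inner_swap : ∀ x y z w, ⟪G x y z, w⟫ = ⟪G x y w, z⟫
  eikonal : ∀ x, ⟪G x x x, G x x x⟫ = ⟪x, x⟫ ^ 3

namespace IsEikonalForm

variable {E : Type*} [NormedAddCommGroup E] [InnerProductSpace ℝ E]
  {G : E →ₗ[ℝ] E →ₗ[ℝ] E →ₗ[ℝ] E}

theorem neg (h : IsEikonalForm G) : IsEikonalForm (-G) where
  swap₁₂ x y z := by simp [h.swap₁₂ x y z]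
  swap₂₃ x y z := by simp [h.swap₂₃ x y z]
  inner_swap x y z w := by simp [h.inner_swap x y z w]
  eikonal x := by simpa using h.eikonal x

theorem inner_swap₁ (h : IsEikonalForm G) (x y z w : E) : ⟪G x y z, w⟫ = ⟪G w y z, x⟫ := by
  rw [h.swap₁₂, h.swap₂₃, h.inner_swap, h.swap₂₃, h.swap₁₂]

theorem cube_add (h : IsEikonalForm G) (x y : E) :
    G (x + y) (x + y) (x + y)
      = G x x x + (3 : ℝ) • G x x y + (3 : ℝ) • G x y y + G y y y := by
  have h1 : G x y x = G x x y := h.swap₂₃ _ _ _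
  have h2 : G y x x = G x x y := by rw [h.swap₁₂, h1]
  have h3 : G y x y = G x y y := h.swap₁₂ _ _ _
  have h4 : G y y x = G x y y := by rw [h.swap₂₃, h3]
  simp only [map_add, LinearMap.add_apply, h1, h2, h3, h4]
  module

/-- The eikonal identity at `x + t y`, compared in degrees one, two and three in `t`. -/
theorem polarised (h : IsEikonalForm G) (x y : E) :
    ⟪G x x x, G x x y⟫ = ⟪x, x⟫ ^ 2 * ⟪x, y⟫ ∧
    2 * ⟪G x x x, G x y y⟫ + 3 * ⟪G x x y, G x x y⟫
      = ⟪x, x⟫ ^ 2 * ⟪y, y⟫ + 4 * ⟪x, x⟫ * ⟪x, y⟫ ^ 2 ∧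
    2 * ⟪G x x x, G y y y⟫ + 18 * ⟪G x x y, G x y y⟫
      = 12 * ⟪x, x⟫ * ⟪x, y⟫ * ⟪y, y⟫ + 8 * ⟪x, y⟫ ^ 3 := by
  have key := low_coeff_eq_zero_of_forall
    (a₀ := ⟪G x x x, G x x x⟫ - ⟪x, x⟫ ^ 3)
    (a₁ := 6 * ⟪G x x x, G x x y⟫ - 6 * ⟪x, x⟫ ^ 2 * ⟪x, y⟫)
    (a₂ := 6 * ⟪G x x x, G x y y⟫ + 9 * ⟪G x x y, G x x y⟫
      - (3 * ⟪x, x⟫ ^ 2 * ⟪y, y⟫ + 12 * ⟪x, x⟫ * ⟪x, y⟫ ^ 2))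
    (a₃ := 2 * ⟪G x x x, G y y y⟫ + 18 * ⟪G x x y, G x y y⟫
      - (12 * ⟪x, x⟫ * ⟪x, y⟫ * ⟪y, y⟫ + 8 * ⟪x, y⟫ ^ 3))
    (a₄ := 6 * ⟪G x x y, G y y y⟫ + 9 * ⟪G x y y, G x y y⟫
      - (3 * ⟪x, x⟫ * ⟪y, y⟫ ^ 2 + 12 * ⟪y, y⟫ * ⟪x, y⟫ ^ 2))
    (a₅ := 6 * ⟪G x y y, G y y y⟫ - 6 * ⟪y, y⟫ ^ 2 * ⟪x, y⟫)
    (a₆ := ⟪G y y y, G y y y⟫ - ⟪y, y⟫ ^ 3) (by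
    intro t
    have e := h.eikonal (x + t • y)
    rw [h.cube_add] at e
    simp only [map_smul, LinearMap.smul_apply, inner_add_left, inner_add_right,
      real_inner_smul_left, real_inner_smul_right, real_inner_comm (G x x x) (G x x y),
      real_inner_comm (G x x x) (G x y y), real_inner_comm (G x x x) (G y y y),
      real_inner_comm (G x x y) (G x y y), real_inner_comm (G x x y) (G y y y),
      real_inner_comm (G x y y) (G y y y), real_inner_comm x y] at e
    linear_combination e)
  obtain ⟨k1, k2, k3⟩ := key
  refine ⟨by linarith, by linarith, by linarith⟩

theorem quartic_le (h : IsEikonalForm G) {x : E} (hx : ⟪x, x⟫ = 1) :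
    ⟪G x x x, x⟫ ^ 2 ≤ 1 := by
  have := real_inner_mul_inner_self_le (G x x x) x
  rw [h.eikonal, hx] at this
  nlinarith

/-- Equality in the Cauchy-Schwarz inequality for `G x x x` and `x`. -/
theorem apply_eq_of_quartic (h : IsEikonalForm G) {x : E} (hx : ⟪G x x x, x⟫ = ⟪x, x⟫ ^ 2) :
    G x x x = ⟪x, x⟫ • x := by
  apply eq_of_inner_self
  · rw [h.eikonal, real_inner_smul_left, real_inner_smul_right]; ring
  · rw [real_inner_smul_left, real_inner_smul_right, real_inner_smul_right, hx]; ring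

end IsEikonalForm

/-! ### The decomposition of the space at a focal point -/

/-- A unit vector at which the quartic form `⟪G x x x, x⟫` takes its largest possible value on the
unit sphere, that is, a point of the focal variety `{|x| = 1, f = 1}`; by
`IsEikonalForm.apply_eq_of_quartic` this means `G e e e = e`. -/
structure IsFocal {E : Type*} [NormedAddCommGroup E] [InnerProductSpace ℝ E]
    (G : E →ₗ[ℝ] E →ₗ[ℝ] E →ₗ[ℝ] E) (e : E) : Prop where
  unit : ⟪e, e⟫ = 1
  apply_self : G e e e = e

/-- The tangent space at `e` of the focal variety: the eigenspace of the Hessian, normalised as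
`G e e`, for the eigenvalue `1/3`. -/
noncomputable def focalTangent {E : Type*} [NormedAddCommGroup E] [InnerProductSpace ℝ E]
    (G : E →ₗ[ℝ] E →ₗ[ℝ] E →ₗ[ℝ] E) (e : E) : Submodule ℝ E :=
  Module.End.eigenspace (G e e) (1 / 3)

/-- The normal space at `e` of the focal variety in the sphere: the eigenspace of the Hessian,
normalised as `G e e`, for the eigenvalue `-1`. -/
noncomputable def focalNormal {E : Type*} [NormedAddCommGroup E] [InnerProductSpace ℝ E]
    (G : E →ₗ[ℝ] E →ₗ[ℝ] E →ₗ[ℝ] E) (e : E) : Submodule ℝ E :=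
  Module.End.eigenspace (G e e) (-1)

namespace IsEikonalForm

variable {E : Type*} [NormedAddCommGroup E] [InnerProductSpace ℝ E]
  {G : E →ₗ[ℝ] E →ₗ[ℝ] E →ₗ[ℝ] E} {e : E}

theorem mem_tangent {x : E} : x ∈ focalTangent G e ↔ G e e x = (1 / 3 : ℝ) • x :=
  Module.End.mem_eigenspace_iff

theorem mem_normal {x : E} : x ∈ focalNormal G e ↔ G e e x = -x := by
  rw [focalNormal, Module.End.mem_eigenspace_iff, neg_one_smul]

theorem inner_tangent (h : IsEikonalForm G) (he : IsFocal G e) {x : E}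
    (hx : x ∈ focalTangent G e) : ⟪e, x⟫ = 0 := by
  have := h.inner_swap e e e x
  rw [he.apply_self, mem_tangent.1 hx, real_inner_smul_left, real_inner_comm e x] at this
  linarith

theorem inner_normal (h : IsEikonalForm G) (he : IsFocal G e) {x : E}
    (hx : x ∈ focalNormal G e) : ⟪e, x⟫ = 0 := by
  have := h.inner_swap e e e x
  rw [he.apply_self, mem_normal.1 hx, inner_neg_left, real_inner_comm e x] at this
  linarith

theorem inner_tangent_normal (h : IsEikonalForm G) {x y : E}
    (hx : x ∈ focalTangent G e) (hy : y ∈ focalNormal G e) : ⟪x, y⟫ = 0 := by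
  have := h.inner_swap e e x y
  rw [mem_tangent.1 hx, mem_normal.1 hy, inner_neg_left, real_inner_smul_left,
    real_inner_comm x y] at this
  linarith

/-- The second-order part of the eikonal identity at a focal point. -/
theorem hessian_quadratic (h : IsEikonalForm G) (he : IsFocal G e) {y : E} (hy : ⟪e, y⟫ = 0) :
    2 * ⟪G e e y, y⟫ + 3 * ⟪G e e y, G e e y⟫ = ⟪y, y⟫ := by
  have := (h.polarised e y).2.1
  rw [he.apply_self, he.unit, hy, real_inner_comm, h.inner_swap₁, real_inner_comm] at this
  have h2 : ⟪G e y y, e⟫ = ⟪G e e y, y⟫ := by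
    rw [h.inner_swap, h.swap₂₃]
  have h3 := real_inner_comm e (G e y y)
  have h4 := real_inner_comm y (G e e y)
  linarith

/-- The polarised form of `hessian_quadratic`: on the orthogonal complement of `e` the operator
`G e e` satisfies `3 B² + 2 B - 1 = 0`, so that its eigenvalues there are `1/3` and `-1`. -/
theorem hessian_sq (h : IsEikonalForm G) (he : IsFocal G e) {y : E} (hy : ⟪e, y⟫ = 0) :
    (3 : ℝ) • G e e (G e e y) + (2 : ℝ) • G e e y - y = 0 := by
  have sym : ∀ x z, ⟪G e e x, z⟫ = ⟪G e e z, x⟫ := h.inner_swap e e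
  have hB : ∀ z, ⟪e, z⟫ = 0 → ⟪e, G e e z⟫ = 0 := fun z hz => by
    rw [real_inner_comm, sym, he.apply_self, hz]
  set w := (3 : ℝ) • G e e (G e e y) + (2 : ℝ) • G e e y - y with hw
  have hwe : ⟪e, w⟫ = 0 := by
    rw [hw, inner_sub_right, inner_add_right, real_inner_smul_right, real_inner_smul_right,
      hB _ (hB _ hy), hB _ hy, hy]; ring
  have hyw : ⟪e, y + w⟫ = 0 := by rw [inner_add_right, hy, hwe, add_zero]
  have q1 := h.hessian_quadratic he hyw
  have q2 := h.hessian_quadratic he hy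
  have q3 := h.hessian_quadratic he hwe
  have c1 : ⟪G e e w, y⟫ = ⟪G e e y, w⟫ := sym _ _
  have c2 : ⟪G e e w, G e e y⟫ = ⟪G e e y, G e e w⟫ := real_inner_comm _ _
  have c3 : ⟪G e e (G e e y), w⟫ = ⟪G e e y, G e e w⟫ := by rw [sym, real_inner_comm]
  have c4 : ⟪w, y⟫ = ⟪y, w⟫ := real_inner_comm _ _
  simp only [map_add, inner_add_left, inner_add_right] at q1
  have : ⟪w, w⟫ = 0 := by
    conv_lhs => arg 2; rw [hw]
    rw [inner_sub_left, inner_add_left, real_inner_smul_left, real_inner_smul_left]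
    linarith
  exact inner_self_eq_zero.1 this

/-- The orthogonal complement of a focal point is the sum of the tangent space and the normal
space. -/
theorem exists_tangent_add_normal (h : IsEikonalForm G) (he : IsFocal G e) {y : E}
    (hy : ⟪e, y⟫ = 0) : ∃ ξ ∈ focalTangent G e, ∃ η ∈ focalNormal G e, y = ξ + η := by
  have hs := h.hessian_sq he hy
  refine ⟨(3 / 4 : ℝ) • (G e e y + y), mem_tangent.2 ?_,
    (-1 / 4 : ℝ) • ((3 : ℝ) • G e e y - y), mem_normal.2 ?_, by module⟩
  · simp only [map_smul, map_add]
    linear_combination (norm := module) (1 / 4 : ℝ) • hs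
  · simp only [map_smul, map_sub]
    linear_combination (norm := module) (-1 / 4 : ℝ) • hs

theorem exists_decomposition (h : IsEikonalForm G) (he : IsFocal G e) (x : E) :
    ∃ ξ ∈ focalTangent G e, ∃ η ∈ focalNormal G e, x = ⟪e, x⟫ • e + ξ + η := by
  obtain ⟨ξ, hξ, η, hη, hx⟩ := h.exists_tangent_add_normal he (y := x - ⟪e, x⟫ • e) (by
    rw [inner_sub_right, real_inner_smul_right, he.unit]; ring)
  refine ⟨ξ, hξ, η, hη, ?_⟩
  rw [add_assoc, ← hx]; abel

/-- Vectors can be compared on the three summands of the decomposition at a focal point. -/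
theorem ext_focal (h : IsEikonalForm G) (he : IsFocal G e) {v w : E} (h0 : ⟪v, e⟫ = ⟪w, e⟫)
    (hL : ∀ ξ ∈ focalTangent G e, ⟪v, ξ⟫ = ⟪w, ξ⟫)
    (hM : ∀ η ∈ focalNormal G e, ⟪v, η⟫ = ⟪w, η⟫) : v = w := by
  refine ext_inner_right ℝ fun x => ?_
  obtain ⟨ξ, hξ, η, hη, hx⟩ := h.exists_decomposition he x
  rw [hx]
  simp only [inner_add_right, real_inner_smul_right, h0, hL ξ hξ, hM η hη]

/-- A symmetric trilinear form that vanishes on the diagonal vanishes. -/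
theorem cubic_polar (h : IsEikonalForm G) (a : E) (S : Submodule ℝ E)
    (hS : ∀ x ∈ S, ⟪G a x x, x⟫ = 0) {x y z : E} (hx : x ∈ S) (hy : y ∈ S) (hz : z ∈ S) :
    ⟪G a x y, z⟫ = 0 := by
  have e1 := hS _ (S.add_mem (S.add_mem hx hy) hz)
  have e2 := hS _ (S.add_mem hx hy)
  have e3 := hS _ (S.add_mem hx hz)
  have e4 := hS _ (S.add_mem hy hz)
  have s1 : ∀ p q, G a p q = G a q p := h.swap₂₃ a
  have s2 : ∀ p q r, ⟪G a p q, r⟫ = ⟪G a p r, q⟫ := h.inner_swap a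
  have p1 : ⟪G a x z, y⟫ = ⟪G a x y, z⟫ := s2 _ _ _
  have p2 : ⟪G a y z, x⟫ = ⟪G a x y, z⟫ := by rw [s2, s1]
  have pp : ∀ p q, ⟪G a p p, q⟫ = ⟪G a p q, p⟫ := fun p q => s2 _ _ _
  simp only [map_add, LinearMap.add_apply, inner_add_left, inner_add_right, s1 y x, s1 z x,
    s1 z y, hS x hx, hS y hy, hS z hz, p1, p2, pp] at e1 e2 e3 e4
  linarith

/-- The third-order part of the eikonal identity at a focal point. -/
theorem hessian_cubic (h : IsEikonalForm G) (he : IsFocal G e) {y : E} (hy : ⟪e, y⟫ = 0) :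
    ⟪G e y y, y⟫ + 9 * ⟪G e y y, G e e y⟫ = 0 := by
  have := (h.polarised e y).2.2
  have h1 : ⟪e, G y y y⟫ = ⟪G e y y, y⟫ := by rw [real_inner_comm, h.inner_swap₁]
  rw [he.apply_self, he.unit, hy, h1, real_inner_comm (G e y y)] at this
  linarith

section Cubic

variable (h : IsEikonalForm G) (he : IsFocal G e)
include h he

theorem cubic_tangent {x y z : E} (hx : x ∈ focalTangent G e) (hy : y ∈ focalTangent G e)
    (hz : z ∈ focalTangent G e) : ⟪G e x y, z⟫ = 0 := by
  refine h.cubic_polar e _ (fun x hx => ?_) hx hy hz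
  have := h.hessian_cubic he (h.inner_tangent he hx)
  rw [mem_tangent.1 hx, real_inner_smul_right] at this
  linarith

theorem cubic_normal {x y z : E} (hx : x ∈ focalNormal G e) (hy : y ∈ focalNormal G e)
    (hz : z ∈ focalNormal G e) : ⟪G e x y, z⟫ = 0 := by
  refine h.cubic_polar e _ (fun x hx => ?_) hx hy hz
  have := h.hessian_cubic he (h.inner_normal he hx)
  rw [mem_normal.1 hx, inner_neg_right] at this
  linarith

theorem cubic_normal_tangent {x y z : E} (hx : x ∈ focalNormal G e) (hy : y ∈ focalNormal G e)
    (hz : z ∈ focalTangent G e) : ⟪G e x y, z⟫ = 0 := by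
  have key : ∀ x ∈ focalNormal G e, ⟪G e x x, z⟫ = 0 := fun x hx => by
    have := h.hessian_cubic he (y := z + x)
      (by rw [inner_add_right, h.inner_tangent he hz, h.inner_normal he hx, add_zero])
    have e1 : ⟪G e z x, x⟫ = ⟪G e x x, z⟫ := by rw [h.swap₂₃, h.inner_swap]
    have e2 : ⟪G e x z, x⟫ = ⟪G e x x, z⟫ := h.inner_swap _ _ _ _
    have e3 : ⟪G e x z, z⟫ = ⟪G e z z, x⟫ := by rw [h.swap₂₃, h.inner_swap]
    have e4 : ⟪G e z x, z⟫ = ⟪G e z z, x⟫ := by rw [h.inner_swap]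
    simp only [map_add, LinearMap.add_apply, mem_tangent.1 hz, mem_normal.1 hx, inner_add_left,
      inner_add_right, inner_neg_right, real_inner_smul_right, h.cubic_tangent he hz hz hz,
      h.cubic_normal he hx hx hx, e1, e2, e3, e4] at this
    linarith
  have e1 := key _ (Submodule.add_mem _ hx hy)
  simp only [map_add, LinearMap.add_apply, inner_add_left, key x hx, key y hy,
    h.swap₂₃ e y x] at e1
  linarith

omit he in
theorem apply_normal_self {x : E} (hx : x ∈ focalNormal G e) : G e x e = -x := by
  rw [h.swap₂₃, mem_normal.1 hx]

theorem apply_normal_normal {x y : E} (hx : x ∈ focalNormal G e) (hy : y ∈ focalNormal G e) :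
    G e x y = -⟪x, y⟫ • e := by
  refine h.ext_focal he ?_ (fun ξ hξ => ?_) (fun η hη => ?_)
  · rw [h.inner_swap, h.apply_normal_self hx, real_inner_smul_left, he.unit, inner_neg_left]
    ring
  · rw [h.cubic_normal_tangent he hx hy hξ, real_inner_smul_left, h.inner_tangent he hξ, mul_zero]
  · rw [h.cubic_normal he hx hy hη, real_inner_smul_left, h.inner_normal he hη, mul_zero]

theorem mem_tangent_of_inner {v : E} (h0 : ⟪v, e⟫ = 0) (hv : ∀ η ∈ focalNormal G e, ⟪v, η⟫ = 0) :
    v ∈ focalTangent G e := by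
  rw [mem_tangent]
  refine h.ext_focal he ?_ (fun ξ hξ => ?_) (fun η hη => ?_)
  · rw [h.inner_swap, he.apply_self, real_inner_smul_left, h0, real_inner_comm, h0, mul_zero]
  · rw [h.inner_swap, mem_tangent.1 hξ, real_inner_smul_left, real_inner_smul_left,
      real_inner_comm]
  · rw [h.inner_swap, mem_normal.1 hη, real_inner_smul_left, inner_neg_left, hv η hη,
      real_inner_comm, hv η hη]
    simp

theorem apply_normal_tangent {x y : E} (hx : x ∈ focalNormal G e) (hy : y ∈ focalTangent G e) :
    G e x y ∈ focalTangent G e := by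
  refine h.mem_tangent_of_inner he ?_ fun η hη => ?_
  · rw [h.inner_swap, h.apply_normal_self hx, inner_neg_left, real_inner_comm,
      h.inner_tangent_normal hy hx, neg_zero]
  · rw [h.inner_swap, h.cubic_normal_tangent he hx hη hy]

/-- The fourth-order part of the eikonal identity at a focal point. -/
theorem hessian_quartic {y : E} (hy : ⟪e, y⟫ = 0) :
    2 * ⟪G y y y, G e e y⟫ + 3 * ⟪G e y y, G e y y⟫ = ⟪y, y⟫ ^ 2 := by
  have := (h.polarised y e).2.1
  rw [he.unit, real_inner_comm, real_inner_comm e y, hy, h.swap₁₂ y e e, h.swap₂₃ e y e,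
    h.swap₂₃ y y e, h.swap₁₂ y e y] at this
  rw [real_inner_comm]
  linarith

/-- On the normal space at a focal point the quartic is `|x|⁴`. -/
theorem cube_normal {x : E} (hx : x ∈ focalNormal G e) : G x x x = ⟪x, x⟫ • x := by
  apply h.apply_eq_of_quartic
  have := h.hessian_quartic he (h.inner_normal he hx)
  rw [mem_normal.1 hx, h.apply_normal_normal he hx hx, inner_neg_right, real_inner_smul_left,
    real_inner_smul_right, he.unit] at this
  linarith

theorem sq_apply_normal {x y : E} (hx : x ∈ focalNormal G e) (hy : y ∈ focalNormal G e) :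
    G x x y = (1 / 3 : ℝ) • (⟪x, x⟫ • y + (2 * ⟪x, y⟫) • x) := by
  have e1 := h.cube_normal he (Submodule.add_mem _ hx hy)
  have e2 := h.cube_normal he (Submodule.sub_mem _ hx hy)
  have e3 := h.cube_normal he hy
  have c := real_inner_comm x y
  rw [h.cube_add] at e1
  rw [sub_eq_add_neg, h.cube_add] at e2
  simp only [map_neg, LinearMap.neg_apply, neg_neg, inner_add_left, inner_add_right, inner_neg_left,
    inner_neg_right, c, e3] at e1 e2
  linear_combination (norm := module) (1 / 6 : ℝ) • e1 - (1 / 6 : ℝ) • e2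

theorem sq_apply_normal_self {x : E} (hx : x ∈ focalNormal G e) : G x x e = -⟪x, x⟫ • e := by
  rw [h.swap₂₃, h.swap₁₂, h.apply_normal_normal he hx hx]

theorem quartic_tangent {y : E} (hy : y ∈ focalTangent G e) :
    2 * ⟪G y y y, y⟫ + 9 * ⟪G e y y, G e y y⟫ = 3 * ⟪y, y⟫ ^ 2 := by
  have := h.hessian_quartic he (h.inner_tangent he hy)
  rw [mem_tangent.1 hy, real_inner_smul_right] at this
  linarith

omit he in
theorem inner_apply_tangent_self {x : E} (hx : x ∈ focalTangent G e) :
    ⟪G e x x, e⟫ = 1 / 3 * ⟪x, x⟫ := by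
  rw [h.inner_swap, h.swap₂₃, mem_tangent.1 hx, real_inner_smul_left]

/-- The part of `hessian_quartic` that is quadratic in the normal component `x` and in the
tangential component `y`. -/
theorem quartic_mixed {x y : E} (hx : x ∈ focalNormal G e) (hy : y ∈ focalTangent G e) :
    ⟪G x x y, y⟫ = 3 * ⟪G e x y, G e x y⟫ - ⟪x, x⟫ * ⟪y, y⟫ := by
  have e1 := h.hessian_quartic he (y := y + x)
    (by rw [inner_add_right, h.inner_tangent he hy, h.inner_normal he hx, add_zero])
  have e2 := h.hessian_quartic he (h.inner_tangent he hy)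
  have t1 : ⟪G y y y, x⟫ = ⟪G y y x, y⟫ := h.inner_swap _ _ _ _
  have t2 : ⟪G y x x, y⟫ = ⟪G x x y, y⟫ := by rw [h.swap₁₂, h.swap₂₃]
  have t3 : ⟪G y y x, x⟫ = ⟪G x x y, y⟫ := by rw [h.inner_swap₁, h.swap₂₃]
  have t4 : ⟪G x x x, y⟫ = 0 := by
    rw [h.cube_normal he hx, real_inner_smul_left, real_inner_comm y x,
      h.inner_tangent_normal hy hx, mul_zero]
  have t5 : ⟪G y x x, x⟫ = 0 := by rw [h.inner_swap₁, t4]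
  have t6 : ⟪G x x x, x⟫ = ⟪x, x⟫ ^ 2 := by
    rw [h.cube_normal he hx, real_inner_smul_left]; ring
  have t7 : ⟪G e y y, G e x y⟫ = 0 := h.cubic_tangent he hy hy (h.apply_normal_tangent he hx hy)
  have t8 := h.inner_apply_tangent_self hy
  have t9 : ⟪G e x y, e⟫ = 0 := by
    rw [real_inner_comm, h.inner_tangent he (h.apply_normal_tangent he hx hy)]
  have t10 : ⟪y, x⟫ = 0 := h.inner_tangent_normal hy hx
  have t11 : ⟪x, y⟫ = 0 := by rw [real_inner_comm, t10]
  have sq : G e (y + x) (y + x) = G e y y + (2 : ℝ) • G e x y - ⟪x, x⟫ • e := by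
    simp only [map_add, LinearMap.add_apply, h.apply_normal_normal he hx hx, h.swap₂₃ e y x]
    module
  have t12 : ⟪G e x y, G e y y⟫ = 0 := by rw [real_inner_comm, t7]
  rw [sq, h.cube_add] at e1
  simp only [map_add, mem_tangent.1 hy, mem_normal.1 hx, inner_add_left, inner_add_right,
    inner_sub_left, inner_sub_right, inner_neg_right, real_inner_smul_left, real_inner_smul_right,
    t1, t2, t3, t4, t5, t6, t7, t8, t9, t10, t11, t12, he.unit, real_inner_comm (G e y y) e,
    real_inner_comm (G e x y) e] at e1 e2
  linarith

/-- The Hessian at a normal vector `x`, on the tangent space at `e`, is determined by the shape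
operator in the direction `x`. -/
theorem sq_apply_tangent {x y : E} (hx : x ∈ focalNormal G e) (hy : y ∈ focalTangent G e) :
    G x x y = (3 : ℝ) • G e x (G e x y) - ⟪x, x⟫ • y := by
  have hy0 : ⟪y, e⟫ = 0 := by rw [real_inner_comm, h.inner_tangent he hy]
  have hA := h.apply_normal_tangent he hx hy
  have hAA := h.apply_normal_tangent he hx hA
  refine h.ext_focal he ?_ (fun z hz => ?_) (fun η hη => ?_)
  · rw [h.inner_swap, h.sq_apply_normal_self he hx, real_inner_smul_left, h.inner_tangent he hy,
      inner_sub_left, real_inner_smul_left, real_inner_smul_left, hy0,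
      real_inner_comm e (G e x _), h.inner_tangent he hAA]
    ring
  · have e1 := h.quartic_mixed he hx (Submodule.add_mem _ hy hz)
    have e2 := h.quartic_mixed he hx hy
    have e3 := h.quartic_mixed he hx hz
    have c1 : ⟪G x x z, y⟫ = ⟪G x x y, z⟫ := h.inner_swap _ _ _ _
    have c2 : ⟪G e x (G e x y), z⟫ = ⟪G e x y, G e x z⟫ := by
      rw [h.inner_swap, real_inner_comm]
    simp only [map_add, inner_add_left, inner_add_right, c1, real_inner_comm y z,
      real_inner_comm (G e x y) (G e x z)] at e1
    rw [inner_sub_left, real_inner_smul_left, real_inner_smul_left, c2]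
    linarith
  · rw [h.inner_swap, h.sq_apply_normal he hx hη, inner_sub_left]
    have a1 : ⟪η, y⟫ = 0 := by rw [real_inner_comm, h.inner_tangent_normal hy hη]
    have a2 : ⟪x, y⟫ = 0 := by rw [real_inner_comm, h.inner_tangent_normal hy hx]
    simp only [real_inner_smul_left, inner_add_left, a1, a2, h.inner_tangent_normal hy hη,
      h.inner_tangent_normal hAA hη]
    ring

/-- Unit normal vectors of the focal variety at a point of it belong to the focal variety. -/
theorem isFocal_normal {x : E} (hx : x ∈ focalNormal G e) (hx1 : ⟪x, x⟫ = 1) : IsFocal G x :=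
  ⟨hx1, by rw [h.cube_normal he hx, hx1, one_smul]⟩

/-- The shape operators of the focal variety have eigenvalues `0` and `±1`; up to the factor `3/2`,
the operator `G e x` is the shape operator in the direction `x`. -/
theorem shape_cube {x y : E} (hx : x ∈ focalNormal G e) (hx1 : ⟪x, x⟫ = 1)
    (hy : y ∈ focalTangent G e) :
    (9 : ℝ) • G e x (G e x (G e x y)) = (4 : ℝ) • G e x y := by
  have hxy : ⟪x, y⟫ = 0 := by rw [real_inner_comm, h.inner_tangent_normal hy hx]
  have tang : ∀ z ∈ focalTangent G e, G e x z ∈ focalTangent G e :=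
    fun z hz => h.apply_normal_tangent he hx hz
  -- The eigenvalue equation of the Hessian at the focal point `x`, read through
  -- `sq_apply_tangent`, says that the shape operator `A` satisfies `A⁴ = A²`.
  have q := h.hessian_sq (h.isFocal_normal he hx hx1) hxy
  have h4 : (9 : ℝ) • G e x (G e x (G e x (G e x y))) = (4 : ℝ) • G e x (G e x y) := by
    have hB : ∀ z ∈ focalTangent G e, G x x z = (3 : ℝ) • G e x (G e x z) - z := fun z hz => by
      rw [h.sq_apply_tangent he hx hz, hx1, one_smul]
    rw [hB y hy, map_sub, map_smul, hB y hy, hB _ (tang _ (tang _ hy))] at q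
    linear_combination (norm := module) (1 / 3 : ℝ) • q
  -- Since `A` is symmetric, a vector in its image and in its kernel is zero, so `A³ = A`.
  set w := (9 : ℝ) • G e x (G e x (G e x y)) - (4 : ℝ) • G e x y with hw
  have hGw : G e x w = 0 := by
    rw [hw, map_sub, map_smul, map_smul, h4, sub_self]
  have : ⟪w, w⟫ = 0 := by
    have : w = G e x ((9 : ℝ) • G e x (G e x y) - (4 : ℝ) • y) := by
      rw [hw, map_sub, map_smul, map_smul]
    conv_lhs => arg 2; rw [this]
    rw [h.inner_swap, hGw, inner_zero_left]
  rw [← sub_eq_zero, ← hw]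
  exact inner_self_eq_zero.1 this

end Cubic

end IsEikonalForm

/-! ### Totally geodesic focal varieties and focal hypersurfaces -/

namespace IsEikonalForm

section General

variable {E : Type*} [NormedAddCommGroup E] [InnerProductSpace ℝ E]
  {G : E →ₗ[ℝ] E →ₗ[ℝ] E →ₗ[ℝ] E} {e : E}

theorem quartic_add (h : IsEikonalForm G) (x y : E) :
    ⟪G (x + y) (x + y) (x + y), x + y⟫ = ⟪G x x x, x⟫ + 4 * ⟪G x x x, y⟫ + 6 * ⟪G x x y, y⟫
      + 4 * ⟪G y y y, x⟫ + ⟪G y y y, y⟫ := by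
  have e1 : ⟪G x x y, x⟫ = ⟪G x x x, y⟫ := h.inner_swap _ _ _ _
  have e2 : ⟪G x y y, x⟫ = ⟪G x x y, y⟫ := by rw [h.inner_swap, h.swap₂₃]
  have e3 : ⟪G x y y, y⟫ = ⟪G y y y, x⟫ := h.inner_swap₁ _ _ _ _
  rw [h.cube_add]
  simp only [inner_add_left, inner_add_right, real_inner_smul_left, e1, e2, e3]
  ring

variable (h : IsEikonalForm G) (he : IsFocal G e)
include h he

/-- Where all shape operators vanish, the tangent vectors are maximum points too. -/
theorem quartic_tangent_of_shape_zero
    (hA : ∀ x ∈ focalNormal G e, ∀ y ∈ focalTangent G e, G e x y = 0)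
    {y : E} (hy : y ∈ focalTangent G e) : G e y y = (1 / 3 * ⟪y, y⟫) • e ∧
      G y y y = ⟪y, y⟫ • y := by
  have h1 : G e y y = (1 / 3 * ⟪y, y⟫) • e := by
    refine h.ext_focal he ?_ (fun ξ hξ => ?_) (fun η hη => ?_)
    · rw [h.inner_apply_tangent_self hy, real_inner_smul_left, he.unit, mul_one]
    · rw [h.cubic_tangent he hy hy hξ, real_inner_smul_left, h.inner_tangent he hξ, mul_zero]
    · rw [h.inner_swap, h.swap₂₃, hA η hη y hy, real_inner_smul_left, h.inner_normal he hη,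
        inner_zero_left, mul_zero]
  refine ⟨h1, h.apply_eq_of_quartic ?_⟩
  have h2 := h.quartic_tangent he hy
  rw [h1, real_inner_smul_left, real_inner_smul_right, he.unit] at h2
  linarith

theorem cube_of_shape_zero
    (hA : ∀ x ∈ focalNormal G e, ∀ y ∈ focalTangent G e, G e x y = 0)
    {y : E} (hy : y ∈ focalTangent G e) (s : ℝ) :
    G (s • e + y) (s • e + y) (s • e + y) = ⟪s • e + y, s • e + y⟫ • (s • e + y) := by
  obtain ⟨h1, h2⟩ := h.quartic_tangent_of_shape_zero he hA hy
  rw [h.cube_add]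
  simp only [map_smul, LinearMap.smul_apply, h1, h2, he.apply_self, mem_tangent.1 hy,
    inner_add_left, inner_add_right, real_inner_smul_left, real_inner_smul_right, he.unit,
    h.inner_tangent he hy, real_inner_comm e y]
  module

/-- Where all shape operators vanish, the quartic is determined by the normal space. -/
theorem quartic_of_shape_zero
    (hA : ∀ x ∈ focalNormal G e, ∀ y ∈ focalTangent G e, G e x y = 0)
    {y η : E} (hy : y ∈ focalTangent G e) (hη : η ∈ focalNormal G e) (s : ℝ) :
    ⟪G (s • e + y + η) (s • e + y + η) (s • e + y + η), s • e + y + η⟫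
      = ⟪s • e + y, s • e + y⟫ ^ 2 - 6 * ⟪s • e + y, s • e + y⟫ * ⟪η, η⟫ + ⟪η, η⟫ ^ 2 := by
  have h3 : G η η (s • e + y) = -⟪η, η⟫ • (s • e + y) := by
    rw [map_add, map_smul, h.sq_apply_normal_self he hη, h.sq_apply_tangent he hη hy, hA η hη y hy,
      map_zero]
    module
  have h4 : ⟪s • e + y, η⟫ = 0 := by
    rw [inner_add_left, real_inner_smul_left, h.inner_normal he hη, h.inner_tangent_normal hy hη]
    ring
  have h5 : ⟪G (s • e + y) (s • e + y) η, η⟫ = -⟪η, η⟫ * ⟪s • e + y, s • e + y⟫ := by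
    rw [h.inner_swap₁, h.swap₂₃, h3, real_inner_smul_left]
  rw [h.quartic_add, h5, h.cube_of_shape_zero he hA hy, h.cube_normal he hη,
    real_inner_smul_left, real_inner_smul_left, real_inner_smul_left, real_inner_smul_left,
    real_inner_comm (s • e + y) η, h4]
  ring

/-! The case of a normal space that is a line, spanned by the unit vector `η`. -/

section Codim

variable {η : E} (hη : η ∈ focalNormal G e) (hη1 : ⟪η, η⟫ = 1)
  (hM : ∀ x ∈ focalNormal G e, ∃ t : ℝ, x = t • η)
include hη hη1 hM

theorem apply_tangent_of_codim_one {y : E} (hy : y ∈ focalTangent G e) :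
    G e y y = (1 / 3 * ⟪y, y⟫) • e + ⟪G e η y, y⟫ • η := by
  refine h.ext_focal he ?_ (fun ξ hξ => ?_) (fun x hx => ?_)
  · rw [h.inner_apply_tangent_self hy, inner_add_left, real_inner_smul_left, real_inner_smul_left,
      he.unit, real_inner_comm e η, h.inner_normal he hη]
    ring
  · rw [h.cubic_tangent he hy hy hξ, inner_add_left, real_inner_smul_left, h.inner_tangent he hξ,
      real_inner_smul_left, real_inner_comm ξ η, h.inner_tangent_normal hξ hη]
    ring
  · obtain ⟨t, rfl⟩ := hM x hx
    have : ⟪G e y y, η⟫ = ⟪G e η y, y⟫ := by rw [h.inner_swap, h.swap₂₃]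
    simp only [real_inner_smul_right, inner_add_left, real_inner_smul_left, this, hη1,
      h.inner_normal he hη]
    ring

theorem quartic_tangent_of_codim_one {y : E} (hy : y ∈ focalTangent G e) :
    ⟪G y y y, y⟫ = ⟪y, y⟫ ^ 2 - 9 / 2 * ⟪G e η y, y⟫ ^ 2 := by
  have h2 := h.quartic_tangent he hy
  rw [h.apply_tangent_of_codim_one he hη hη1 hM hy] at h2
  simp only [inner_add_left, inner_add_right, real_inner_smul_left, real_inner_smul_right,
    he.unit, hη1, h.inner_normal he hη, real_inner_comm e η] at h2
  linarith

/-- The tangential component of the gradient at a tangent vector, obtained by differentiating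
`quartic_tangent_of_codim_one`; the component along `η` turns out to vanish in
`cube_tangent_normal_of_codim_one`. -/
theorem cube_tangent_of_codim_one {y : E} (hy : y ∈ focalTangent G e) :
    G y y y = ⟪y, y⟫ • y - (9 / 2 * ⟪G e η y, y⟫) • G e η y + ⟪G y y y, η⟫ • η := by
  have hA := h.apply_normal_tangent he hη hy
  refine h.ext_focal he ?_ (fun z hz => ?_) (fun x hx => ?_)
  · have : ⟪G y y y, e⟫ = 0 := by rw [h.inner_swap₁, h.cubic_tangent he hy hy hy]
    simp only [this, inner_add_left, inner_sub_left, real_inner_smul_left, real_inner_comm e y,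
      real_inner_comm e η, real_inner_comm e (G e η y), h.inner_tangent he hy,
      h.inner_tangent he hA, h.inner_normal he hη]
    ring
  · -- the derivative at `t = 0` of the quartic at `y + t z`
    have key := low_coeff_eq_zero_of_forall (a₀ := 0)
      (a₁ := 4 * ⟪G y y y, z⟫ - 4 * ⟪y, y⟫ * ⟪y, z⟫ + 18 * ⟪G e η y, y⟫ * ⟪G e η y, z⟫)
      (a₂ := 6 * ⟪G y y z, z⟫ - 2 * ⟪y, y⟫ * ⟪z, z⟫ - 4 * ⟪y, z⟫ ^ 2
        + 9 * ⟪G e η y, y⟫ * ⟪G e η z, z⟫ + 18 * ⟪G e η y, z⟫ ^ 2)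
      (a₃ := 4 * ⟪G z z z, y⟫ - 4 * ⟪z, z⟫ * ⟪y, z⟫ + 18 * ⟪G e η z, z⟫ * ⟪G e η y, z⟫)
      (a₄ := 0) (a₅ := 0) (a₆ := 0) (by
        intro t
        have e1 := h.quartic_tangent_of_codim_one he hη hη1 hM
          (Submodule.add_mem _ hy (Submodule.smul_mem _ t hz))
        have e2 := h.quartic_tangent_of_codim_one he hη hη1 hM hy
        have e3 := h.quartic_tangent_of_codim_one he hη hη1 hM hz
        have c1 : ⟪G e η z, y⟫ = ⟪G e η y, z⟫ := h.inner_swap _ _ _ _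
        rw [h.quartic_add] at e1
        simp only [map_add, map_smul, LinearMap.smul_apply, inner_add_left, inner_add_right,
          real_inner_smul_left, real_inner_smul_right, c1, real_inner_comm y z, e2, e3] at e1
        linear_combination e1)
    have hzη : ⟪η, z⟫ = 0 := by rw [real_inner_comm, h.inner_tangent_normal hz hη]
    simp only [inner_add_left, inner_sub_left, real_inner_smul_left, hzη]
    linarith [key.1]
  · obtain ⟨t, rfl⟩ := hM x hx
    simp only [inner_add_left, inner_sub_left, real_inner_smul_left, real_inner_smul_right, hη1,
      h.inner_tangent_normal hy hη, h.inner_tangent_normal hA hη]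
    ring

/-- The eikonal equation at a tangent vector `y`: with `A` the shape operator in the direction `η`,
either `⟪A y, y⟫ = 0` or `|A y| = |y|`. -/
theorem cube_tangent_normal_of_codim_one {y : E} (hy : y ∈ focalTangent G e) :
    ⟪G y y y, η⟫ = 0 ∧
      ⟪G e η y, y⟫ ^ 2 * (4 * ⟪y, y⟫ - 9 * ⟪G e η y, G e η y⟫) = 0 := by
  have hA := h.apply_normal_tangent he hη hy
  have k1 := (h.polarised y e).1
  have k2 : ⟪G y y y, e⟫ = 0 := by rw [h.inner_swap₁, h.cubic_tangent he hy hy hy]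
  have hye : ⟪y, e⟫ = 0 := by rw [real_inner_comm, h.inner_tangent he hy]
  rw [h.swap₂₃ y y e, h.swap₁₂ y e y, h.apply_tangent_of_codim_one he hη hη1 hM hy, inner_add_right,
    real_inner_smul_right, real_inner_smul_right, k2, hye] at k1
  have k3 := h.eikonal y
  rw [h.cube_tangent_of_codim_one he hη hη1 hM hy] at k3
  simp only [inner_add_left, inner_add_right, inner_sub_left, inner_sub_right,
    real_inner_smul_left, real_inner_smul_right, hη1,
    h.inner_tangent_normal hy hη, h.inner_tangent_normal hA hη,
    real_inner_comm y η, real_inner_comm (G e η y) η, real_inner_comm (G e η y) y] at k3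
  have k4 : ⟪G e η y, y⟫ * ⟪G y y y, η⟫ = 0 := by linarith
  have k5 : ⟪G y y y, η⟫ = 0 := by
    rcases mul_eq_zero.1 k4 with h0 | h0
    · rw [h0] at k3
      have : ⟪G y y y, η⟫ ^ 2 = 0 := by linarith
      exact pow_eq_zero_iff (two_ne_zero) |>.1 this
    · exact h0
  refine ⟨k5, ?_⟩
  rw [k5] at k3
  linarith

/-- A nonzero shape operator is an involution: if `z` is an eigenvector for one of the eigenvalues
`±1` and `w` is in the kernel, then `cube_tangent_normal_of_codim_one` at `z + w` forces `w = 0`. -/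
theorem shape_sq_of_codim_one (hA : ∃ y ∈ focalTangent G e, G e η y ≠ 0) {y : E}
    (hy : y ∈ focalTangent G e) : (9 : ℝ) • G e η (G e η y) = (4 : ℝ) • y := by
  have tang : ∀ z ∈ focalTangent G e, G e η z ∈ focalTangent G e :=
    fun z hz => h.apply_normal_tangent he hη hz
  have sym : ∀ p q, ⟪G e η p, q⟫ = ⟪G e η q, p⟫ := h.inner_swap e η
  -- an eigenvector of the shape operator for one of the eigenvalues `±1`
  obtain ⟨z, c, hz, hz0, hc, hcz⟩ : ∃ z, ∃ c : ℝ, z ∈ focalTangent G e ∧ z ≠ 0 ∧ 9 * c ^ 2 = 4 ∧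
      G e η z = c • z := by
    obtain ⟨w, hw, hw0⟩ := hA
    have h3 := h.shape_cube he hη hη1 hw
    by_cases hu : (2 : ℝ) • G e η w + (3 : ℝ) • G e η (G e η w) = 0
    · refine ⟨(2 : ℝ) • G e η w - (3 : ℝ) • G e η (G e η w), -2 / 3,
        Submodule.sub_mem _ (Submodule.smul_mem _ _ (tang _ hw))
          (Submodule.smul_mem _ _ (tang _ (tang _ hw))), fun h0 => hw0 ?_, by norm_num, ?_⟩
      · linear_combination (norm := module) (1 / 4 : ℝ) • hu + (1 / 4 : ℝ) • h0
      · simp only [map_sub, map_smul]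
        linear_combination (norm := module) (-1 / 3 : ℝ) • h3
    · refine ⟨_, 2 / 3, Submodule.add_mem _ (Submodule.smul_mem _ _ (tang _ hw))
          (Submodule.smul_mem _ _ (tang _ (tang _ hw))), hu, by norm_num, ?_⟩
      simp only [map_add, map_smul]
      linear_combination (norm := module) (1 / 3 : ℝ) • h3
  -- the component of `y` in the kernel of the shape operator vanishes
  set w := (4 : ℝ) • y - (9 : ℝ) • G e η (G e η y) with hw
  have hwL : w ∈ focalTangent G e :=
    Submodule.sub_mem _ (Submodule.smul_mem _ _ hy) (Submodule.smul_mem _ _ (tang _ (tang _ hy)))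
  have hw0 : G e η w = 0 := by
    rw [hw, map_sub, map_smul, map_smul, h.shape_cube he hη hη1 hy, sub_self]
  have hc0 : c ≠ 0 := by rintro rfl; norm_num at hc
  have hzw : ⟪z, w⟫ = 0 := by
    have := sym z w
    rw [hcz, hw0, real_inner_smul_left, inner_zero_left] at this
    exact (mul_eq_zero.1 this).resolve_left hc0
  have k := (h.cube_tangent_normal_of_codim_one he hη hη1 hM (Submodule.add_mem _ hz hwL)).2
  simp only [map_add, hcz, hw0, add_zero, inner_add_left, inner_add_right, real_inner_smul_left,
    real_inner_smul_right, hzw, real_inner_comm z w, mul_zero, zero_add] at k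
  have hzz : ⟪z, z⟫ ≠ 0 := fun h0 => hz0 (inner_self_eq_zero.1 h0)
  have k' : (c * ⟪z, z⟫) ^ 2 * (4 * ⟪w, w⟫) = 0 := by
    linear_combination k + (c * ⟪z, z⟫) ^ 2 * ⟪z, z⟫ * hc
  have : ⟪w, w⟫ = 0 := by
    rcases mul_eq_zero.1 k' with h0 | h0
    · exact absurd h0 (pow_ne_zero _ (mul_ne_zero hc0 hzz))
    · linarith
  exact (sub_eq_zero.1 (inner_self_eq_zero.1 this)).symm

/-- Where the normal space is a line and the shape operator is not zero, the quartic is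
`|x|⁴ - 2 q(x)²` for a quadratic form `q`. -/
theorem quartic_of_codim_one (hA : ∃ y ∈ focalTangent G e, G e η y ≠ 0) {y : E}
    (hy : y ∈ focalTangent G e) (s t : ℝ) :
    ⟪G (s • e + t • η + y) (s • e + t • η + y) (s • e + t • η + y), s • e + t • η + y⟫
      = (s ^ 2 + t ^ 2 + ⟪y, y⟫) ^ 2 - 2 * (3 / 2 * ⟪G e η y, y⟫ - 2 * s * t) ^ 2 := by
  have hAy := h.apply_normal_tangent he hη hy
  have e1 : G e e η = -η := mem_normal.1 hη
  have e2 : G e η η = -e := by rw [h.apply_normal_normal he hη hη, hη1, neg_one_smul]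
  have e3 : G η η η = η := (h.isFocal_normal he hη hη1).apply_self
  have hey := h.inner_tangent he hy
  have hηy : ⟪η, y⟫ = 0 := by rw [real_inner_comm, h.inner_tangent_normal hy hη]
  have e4 : G (s • e + t • η) (s • e + t • η) y
      = ((s ^ 2 + t ^ 2) / 3) • y + (2 * s * t) • G e η y := by
    have := h.shape_sq_of_codim_one he hη hη1 hM hA hy
    simp only [map_add, map_smul, LinearMap.add_apply, LinearMap.smul_apply, mem_tangent.1 hy,
      h.sq_apply_tangent he hη hy, h.swap₁₂ η e, hη1]
    linear_combination (norm := module) (t ^ 2 / 3) • this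
  have e5 : ⟪G y y y, e⟫ = 0 := by rw [h.inner_swap₁, h.cubic_tangent he hy hy hy]
  rw [h.quartic_add, e4, h.cube_add, h.quartic_tangent_of_codim_one he hη hη1 hM hy]
  simp only [map_smul, LinearMap.smul_apply, he.apply_self, e1, e2, e3, e5, inner_add_left,
    inner_add_right, real_inner_smul_left, real_inner_smul_right, inner_neg_left, he.unit, hη1,
    h.inner_normal he hη, real_inner_comm e η, hey, hηy,
    (h.cube_tangent_normal_of_codim_one he hη hη1 hM hy).1]
  ring

end Codim

end General

end IsEikonalForm

theorem primitiveForm_eq {n : ℕ} {H : Submodule ℝ (Euc n)} {u v : Euc n} (hu : u ∈ H)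
    (hv : v ∈ Hᗮ) : primitiveForm H (u + v) = ⟪u, u⟫ ^ 2 - 6 * ⟪u, u⟫ * ⟪v, v⟫ + ⟪v, v⟫ ^ 2 := by
  have h1 : H.starProjection (u + v) = u := H.eq_starProjection_of_mem_orthogonal' hu hv rfl
  have h2 : Hᗮ.starProjection (u + v) = v := by
    rw [Submodule.starProjection_orthogonal_val, h1, add_sub_cancel_left]
  rw [primitiveForm, h1, h2, real_inner_self_eq_norm_sq, real_inner_self_eq_norm_sq]
  ring

/-- A symmetric involution `R` with fixed space `H` satisfies `|x|⁴ - 2 ⟪R x, x⟫² = -h_{4,H}(x)`. -/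
theorem primitiveForm_of_involution {n : ℕ} (R : Euc n →ₗ[ℝ] Euc n) (hR : ∀ x, R (R x) = x)
    (hs : ∀ x y, ⟪R x, y⟫ = ⟪R y, x⟫) (x : Euc n) :
    ⟪x, x⟫ ^ 2 - 2 * ⟪R x, x⟫ ^ 2 = -primitiveForm (Module.End.eigenspace R 1) x := by
  have hu : (1 / 2 : ℝ) • (x + R x) ∈ Module.End.eigenspace R 1 := by
    rw [Module.End.mem_eigenspace_iff, map_smul, map_add, hR]
    module
  have hv : (1 / 2 : ℝ) • (x - R x) ∈ (Module.End.eigenspace R 1)ᗮ := by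
    rw [Submodule.mem_orthogonal]
    intro u hu
    rw [Module.End.mem_eigenspace_iff, one_smul] at hu
    have := hs x u
    rw [hu] at this
    rw [real_inner_smul_right, inner_sub_right, real_inner_comm (R x) u, this]
    ring
  have hx : x = (1 / 2 : ℝ) • (x + R x) + (1 / 2 : ℝ) • (x - R x) := by module
  have hRR : ⟪R x, R x⟫ = ⟪x, x⟫ := by rw [hs, hR]
  conv_rhs => rw [hx]
  rw [primitiveForm_eq hu hv]
  simp only [inner_add_left, inner_add_right, inner_sub_left, inner_sub_right,
    real_inner_smul_left, real_inner_smul_right, hRR, real_inner_comm (R x) x]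
  ring

namespace IsEikonalForm

/-- At a focal point of an eikonal quartic that is not of the form `±h_{4,H}`, the focal variety
has codimension at least two in the sphere and is not totally geodesic. -/
theorem codim_and_shape_or_primitive {n : ℕ} {G : Euc n →ₗ[ℝ] Euc n →ₗ[ℝ] Euc n →ₗ[ℝ] Euc n}
    {e : Euc n} (h : IsEikonalForm G) (he : IsFocal G e) :
    (2 ≤ Module.finrank ℝ (focalNormal G e) ∧
      ∃ x ∈ focalNormal G e, ∃ y ∈ focalTangent G e, G e x y ≠ 0) ∨
    ∃ H : Submodule ℝ (Euc n), (∀ x, ⟪G x x x, x⟫ = primitiveForm H x) ∨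
      ∀ x, ⟪G x x x, x⟫ = -primitiveForm H x := by
  by_cases hA : ∀ x ∈ focalNormal G e, ∀ y ∈ focalTangent G e, G e x y = 0
  · refine Or.inr ⟨focalNormal G e, Or.inl fun x => ?_⟩
    obtain ⟨y, hy, η, hη, hx⟩ := h.exists_decomposition he x
    have hperp : ⟪e, x⟫ • e + y ∈ (focalNormal G e)ᗮ := by
      rw [Submodule.mem_orthogonal']
      intro z hz
      rw [inner_add_left, real_inner_smul_left, h.inner_normal he hz, h.inner_tangent_normal hy hz]
      ring
    have hq := h.quartic_of_shape_zero he hA hy hη ⟪e, x⟫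
    rw [← hx] at hq
    have hx' : x = η + (⟪e, x⟫ • e + y) := by rw [add_comm η]; exact hx
    have hp := primitiveForm_eq hη hperp
    rw [← hx'] at hp
    rw [hq, hp]
    ring
  · push Not at hA
    obtain ⟨x, hx, y, hy, hxy⟩ := hA
    by_cases h2 : 2 ≤ Module.finrank ℝ (focalNormal G e)
    · exact Or.inl ⟨h2, x, hx, y, hy, hxy⟩
    right
    have hx0 : x ≠ 0 := by rintro rfl; simp at hxy
    have hxn : ‖x‖ ≠ 0 := norm_ne_zero_iff.2 hx0
    set η := ‖x‖⁻¹ • x with hηdef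
    have hη : η ∈ focalNormal G e := Submodule.smul_mem _ _ hx
    have hη1 : ⟪η, η⟫ = 1 := by
      rw [hηdef, real_inner_smul_left, real_inner_smul_right, real_inner_self_eq_norm_sq]
      field_simp
    have hη0 : η ≠ 0 := by
      intro h0
      rw [h0, inner_zero_left] at hη1
      exact zero_ne_one hη1
    have hA : ∃ y ∈ focalTangent G e, G e η y ≠ 0 := by
      refine ⟨y, hy, ?_⟩
      rw [hηdef, map_smul, LinearMap.smul_apply]
      exact smul_ne_zero (inv_ne_zero hxn) hxy
    have hM : ∀ z ∈ focalNormal G e, ∃ t : ℝ, z = t • η := by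
      have hle : Module.finrank ℝ (focalNormal G e) ≤ 1 := by omega
      intro z hz
      obtain ⟨v, hv⟩ := finrank_le_one_iff.1 hle
      obtain ⟨a, ha⟩ := hv ⟨η, hη⟩
      obtain ⟨b, hb⟩ := hv ⟨z, hz⟩
      have ha' : a • (v : Euc n) = η := congrArg Subtype.val ha
      have hb' : b • (v : Euc n) = z := congrArg Subtype.val hb
      have ha0 : a ≠ 0 := by rintro rfl; exact hη0 (by rw [← ha', zero_smul])
      refine ⟨b / a, ?_⟩
      rw [← ha', ← hb', smul_smul, div_mul_cancel₀ _ ha0]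
    -- the involution whose quadratic form is the square root of `(|x|⁴ - f) / 2`
    set R : Euc n →ₗ[ℝ] Euc n := (3 / 2 : ℝ) • G e η
      + (1 / 2 : ℝ) • ((innerₗ (Euc n) e).smulRight η + (innerₗ (Euc n) η).smulRight e) with hRdef
    have hRa : ∀ z, R z = (3 / 2 : ℝ) • G e η z + (1 / 2 : ℝ) • (⟪e, z⟫ • η + ⟪η, z⟫ • e) := by
      intro z; simp [hRdef]
    have heη := h.inner_normal he hη
    have hηe : ⟪η, e⟫ = 0 := by rw [real_inner_comm, heη]
    have Re : R e = -η := by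
      rw [hRa, h.apply_normal_self hη, he.unit, hηe]; module
    have Rη : R η = -e := by
      rw [hRa, h.apply_normal_normal he hη hη, hη1, heη]; module
    have Rt : ∀ z ∈ focalTangent G e, R z = (3 / 2 : ℝ) • G e η z := by
      intro z hz
      rw [hRa, h.inner_tangent he hz, real_inner_comm, h.inner_tangent_normal hz hη]; module
    have hdec : ∀ z, ∃ (s t : ℝ) (w : Euc n), w ∈ focalTangent G e ∧ z = s • e + t • η + w := by
      intro z
      obtain ⟨w, hw, η', hη', hz⟩ := h.exists_decomposition he z
      obtain ⟨t, rfl⟩ := hM η' hη'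
      exact ⟨_, t, w, hw, hz.trans (by abel)⟩
    have hRR : ∀ z, R (R z) = z := by
      intro z
      obtain ⟨s, t, w, hw, rfl⟩ := hdec z
      have := h.shape_sq_of_codim_one he hη hη1 hM hA hw
      simp only [map_add, map_smul, Re, Rη, Rt w hw, map_neg,
        Rt _ (h.apply_normal_tangent he hη hw)]
      linear_combination (norm := module) (1 / 4 : ℝ) • this
    have hRs : ∀ z w, ⟪R z, w⟫ = ⟪R w, z⟫ := by
      intro z w
      have := h.inner_swap e η z w
      simp only [hRa, inner_add_left, real_inner_smul_left]
      linear_combination (3 / 2 : ℝ) * this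
    refine ⟨Module.End.eigenspace R 1, Or.inr fun z => ?_⟩
    rw [← primitiveForm_of_involution R hRR hRs]
    obtain ⟨s, t, w, hw, rfl⟩ := hdec z
    have hηw : ⟪η, w⟫ = 0 := by rw [real_inner_comm, h.inner_tangent_normal hw hη]
    have hwη : ⟪w, η⟫ = 0 := h.inner_tangent_normal hw hη
    have hew := h.inner_tangent he hw
    have hwe : ⟪w, e⟫ = 0 := by rw [real_inner_comm, hew]
    have hAw := h.apply_normal_tangent he hη hw
    have hAe : ⟪G e η w, e⟫ = 0 := by rw [real_inner_comm, h.inner_tangent he hAw]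
    have hAη : ⟪G e η w, η⟫ = 0 := h.inner_tangent_normal hAw hη
    rw [h.quartic_of_codim_one he hη hη1 hM hA hw]
    simp only [map_add, map_smul, Re, Rη, Rt w hw, inner_add_left, inner_add_right,
      real_inner_smul_left, real_inner_smul_right, inner_neg_left, he.unit, hη1, heη, hηe, hηw,
      hwη, hew, hwe, hAe, hAη]
    ring

end IsEikonalForm

/-! ### Traces and dimensions of the eigenspaces of the shape operators -/

/-- The rank one operator `x ↦ ⟪a, x⟫ b`. -/
noncomputable def dyad {E : Type*} [NormedAddCommGroup E] [InnerProductSpace ℝ E] (a b : E) :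
    E →ₗ[ℝ] E :=
  (innerₗ E a).smulRight b

/-- The orthogonal projection onto the tangent space of the focal variety, expressed through the
Hessian of the quartic. -/
noncomputable def tangentProj {E : Type*} [NormedAddCommGroup E] [InnerProductSpace ℝ E]
    (G : E →ₗ[ℝ] E →ₗ[ℝ] E →ₗ[ℝ] E) (e : E) : E →ₗ[ℝ] E :=
  (3 / 4 : ℝ) • (G e e + LinearMap.id) - (3 / 2 : ℝ) • dyad e e

/-- The orthogonal projection onto the normal space of the focal variety, expressed through the
Hessian of the quartic. -/
noncomputable def normalProj {E : Type*} [NormedAddCommGroup E] [InnerProductSpace ℝ E]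
    (G : E →ₗ[ℝ] E →ₗ[ℝ] E →ₗ[ℝ] E) (e : E) : E →ₗ[ℝ] E :=
  (1 / 4 : ℝ) • (LinearMap.id - (3 : ℝ) • G e e) + (1 / 2 : ℝ) • dyad e e

/-- The shape operator of the focal variety at `e` in the normal direction `η`, extended by zero
to the whole space. -/
noncomputable def shapeOp {E : Type*} [NormedAddCommGroup E] [InnerProductSpace ℝ E]
    (G : E →ₗ[ℝ] E →ₗ[ℝ] E →ₗ[ℝ] E) (e η : E) : E →ₗ[ℝ] E :=
  (3 / 2 : ℝ) • (G e η + dyad e η + dyad η e)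

/-- The eigenspace for the eigenvalue `c` of the shape operator of the focal variety at `e` in the
normal direction `η`. -/
noncomputable def shapeSpace {E : Type*} [NormedAddCommGroup E] [InnerProductSpace ℝ E]
    (G : E →ₗ[ℝ] E →ₗ[ℝ] E →ₗ[ℝ] E) (e η : E) (c : ℝ) : Submodule ℝ E :=
  focalTangent G e ⊓ Module.End.eigenspace ((3 / 2 : ℝ) • G e η) c

section Trace

variable {E : Type*} [NormedAddCommGroup E] [InnerProductSpace ℝ E]

@[simp] theorem dyad_apply (a b x : E) : dyad a b x = ⟪a, x⟫ • b := rfl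

theorem trace_dyad [FiniteDimensional ℝ E] (a b : E) :
    LinearMap.trace ℝ E (dyad a b) = ⟪a, b⟫ := by
  rw [dyad, LinearMap.trace_smulRight]; rfl

/-- The trace of an idempotent operator is the dimension of its image. -/
theorem trace_eq_finrank [FiniteDimensional ℝ E] {P : E →ₗ[ℝ] E} {S : Submodule ℝ E}
    (h1 : ∀ x, P x ∈ S) (h2 : ∀ x ∈ S, P x = x) :
    LinearMap.trace ℝ E P = Module.finrank ℝ S :=
  LinearMap.IsProj.trace ⟨h1, h2⟩

/-- A continuous function with integer values is constant on a preconnected set. -/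
theorem eq_of_preconnected_of_int {X : Type*} [TopologicalSpace X] {S : Set X}
    (hS : IsPreconnected S) {g : X → ℝ} (hg : ContinuousOn g S)
    (hi : ∀ x ∈ S, ∃ m : ℤ, g x = m) {x y : X} (hx : x ∈ S) (hy : y ∈ S) : g x = g y := by
  have aux : ∀ x ∈ S, ∀ y ∈ S, ¬ g x < g y := by
    intro x hx y hy hlt
    obtain ⟨a, ha⟩ := hi x hx
    obtain ⟨b, hb⟩ := hi y hy
    have hab : a + 1 ≤ b := by
      rw [ha, hb] at hlt
      exact_mod_cast hlt
    have hab' : (a : ℝ) + 1 ≤ b := by exact_mod_cast hab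
    obtain ⟨z, hz, hz'⟩ := hS.intermediate_value hx hy hg
      (show (a : ℝ) + 1 / 2 ∈ Set.Icc (g x) (g y) by
        rw [ha, hb]; constructor <;> linarith)
    obtain ⟨c, hc⟩ := hi z hz
    have h2 : (2 * c : ℝ) = 2 * a + 1 := by linarith
    have h3 : 2 * c = 2 * a + 1 := by exact_mod_cast h2
    omega
  exact le_antisymm (not_lt.1 (aux y hy x hx)) (not_lt.1 (aux x hx y hy))

end Trace

namespace IsEikonalForm

variable {E : Type*} [NormedAddCommGroup E] [InnerProductSpace ℝ E]
  {G : E →ₗ[ℝ] E →ₗ[ℝ] E →ₗ[ℝ] E} {e η : E}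

theorem mem_shapeSpace {c : ℝ} {x : E} :
    x ∈ shapeSpace G e η c ↔ x ∈ focalTangent G e ∧ (3 / 2 : ℝ) • G e η x = c • x := by
  rw [shapeSpace, Submodule.mem_inf, Module.End.mem_eigenspace_iff, LinearMap.smul_apply]

section Projections

variable (h : IsEikonalForm G) (he : IsFocal G e)
include h he

omit h in
theorem tangentProj_self : tangentProj G e e = 0 := by
  simp only [tangentProj, LinearMap.sub_apply, LinearMap.smul_apply, LinearMap.add_apply,
    he.apply_self, LinearMap.id_apply, dyad_apply, he.unit]
  module

theorem tangentProj_tangent {x : E} (hx : x ∈ focalTangent G e) : tangentProj G e x = x := by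
  simp only [tangentProj, LinearMap.sub_apply, LinearMap.smul_apply, LinearMap.add_apply,
    mem_tangent.1 hx, LinearMap.id_apply, dyad_apply, h.inner_tangent he hx]
  module

theorem tangentProj_normal {x : E} (hx : x ∈ focalNormal G e) : tangentProj G e x = 0 := by
  simp only [tangentProj, LinearMap.sub_apply, LinearMap.smul_apply, LinearMap.add_apply,
    mem_normal.1 hx, LinearMap.id_apply, dyad_apply, h.inner_normal he hx]
  module

omit h in
theorem normalProj_self : normalProj G e e = 0 := by
  simp only [normalProj, LinearMap.sub_apply, LinearMap.smul_apply, LinearMap.add_apply,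
    he.apply_self, LinearMap.id_apply, dyad_apply, he.unit]
  module

theorem normalProj_tangent {x : E} (hx : x ∈ focalTangent G e) : normalProj G e x = 0 := by
  simp only [normalProj, LinearMap.sub_apply, LinearMap.smul_apply, LinearMap.add_apply,
    mem_tangent.1 hx, LinearMap.id_apply, dyad_apply, h.inner_tangent he hx]
  module

theorem normalProj_normal {x : E} (hx : x ∈ focalNormal G e) : normalProj G e x = x := by
  simp only [normalProj, LinearMap.sub_apply, LinearMap.smul_apply, LinearMap.add_apply,
    mem_normal.1 hx, LinearMap.id_apply, dyad_apply, h.inner_normal he hx]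
  module

theorem shapeOp_self (hη : η ∈ focalNormal G e) : shapeOp G e η e = 0 := by
  simp only [shapeOp, LinearMap.smul_apply, LinearMap.add_apply, h.apply_normal_self hη,
    dyad_apply, he.unit, real_inner_comm e η, h.inner_normal he hη]
  module

theorem shapeOp_tangent (hη : η ∈ focalNormal G e) {x : E} (hx : x ∈ focalTangent G e) :
    shapeOp G e η x = (3 / 2 : ℝ) • G e η x := by
  simp only [shapeOp, LinearMap.smul_apply, LinearMap.add_apply,
    dyad_apply, h.inner_tangent he hx, real_inner_comm x η, h.inner_tangent_normal hx hη]
  module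

theorem shapeOp_mem_tangent (hη : η ∈ focalNormal G e) {x : E} (hx : x ∈ focalTangent G e) :
    shapeOp G e η x ∈ focalTangent G e := by
  rw [h.shapeOp_tangent he hη hx]
  exact Submodule.smul_mem _ _ (h.apply_normal_tangent he hη hx)

theorem shapeOp_normal (hη : η ∈ focalNormal G e) {x : E} (hx : x ∈ focalNormal G e) :
    shapeOp G e η x = 0 := by
  simp only [shapeOp, LinearMap.smul_apply, LinearMap.add_apply,
    dyad_apply, h.inner_normal he hx, h.apply_normal_normal he hη hx]
  module

theorem shapeOp_cube (hη : η ∈ focalNormal G e) (hη1 : ⟪η, η⟫ = 1) {x : E}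
    (hx : x ∈ focalTangent G e) :
    shapeOp G e η (shapeOp G e η (shapeOp G e η x)) = shapeOp G e η x := by
  have h1 := h.apply_normal_tangent he hη hx
  have h2 := h.apply_normal_tangent he hη h1
  have h3 := h.shape_cube he hη hη1 hx
  simp only [h.shapeOp_tangent he hη hx, map_smul, h.shapeOp_tangent he hη h1,
    h.shapeOp_tangent he hη h2]
  linear_combination (norm := module) (3 / 8 : ℝ) • h3

/-- The Hessian at a unit normal vector, expressed through the shape operator at `e`. -/
theorem sq_apply_eq (hη : η ∈ focalNormal G e) (hη1 : ⟪η, η⟫ = 1) :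
    G η η = (4 / 3 : ℝ) • (shapeOp G e η ∘ₗ shapeOp G e η) - tangentProj G e - dyad e e
      + (2 / 3 : ℝ) • dyad η η + (1 / 3 : ℝ) • normalProj G e := by
  ext1 x
  obtain ⟨y, hy, z, hz, hx⟩ := h.exists_decomposition he x
  have hηe : ⟪η, e⟫ = 0 := by rw [real_inner_comm, h.inner_normal he hη]
  have hηy : ⟪η, y⟫ = 0 := by rw [real_inner_comm, h.inner_tangent_normal hy hη]
  generalize ⟪e, x⟫ = s at hx
  subst hx
  simp only [LinearMap.add_apply, LinearMap.sub_apply, LinearMap.smul_apply, LinearMap.comp_apply,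
    map_add, map_smul, h.sq_apply_normal_self he hη, h.sq_apply_normal he hη hz,
    h.sq_apply_tangent he hη hy, hη1, h.shapeOp_self he hη, h.shapeOp_normal he hη hz,
    h.shapeOp_tangent he hη hy, map_zero,
    h.shapeOp_tangent he hη (h.apply_normal_tangent he hη hy), tangentProj_self he,
    h.tangentProj_tangent he hy, h.tangentProj_normal he hz, normalProj_self he,
    h.normalProj_tangent he hy, h.normalProj_normal he hz, dyad_apply, he.unit,
    h.inner_tangent he hy, h.inner_normal he hz, hηe, hηy]
  module

variable [FiniteDimensional ℝ E]

theorem finrank_normal : (Module.finrank ℝ (focalNormal G e) : ℝ)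
    = (Module.finrank ℝ E + 2 - 3 * LinearMap.trace ℝ E (G e e)) / 4 := by
  rw [← trace_eq_finrank (P := normalProj G e) (fun x => ?_)
    (fun x hx => h.normalProj_normal he hx)]
  · simp only [normalProj, map_add, map_smul, map_sub, trace_dyad, he.unit, LinearMap.trace_id,
      smul_eq_mul]
    ring
  · obtain ⟨y, hy, z, hz, hx⟩ := h.exists_decomposition he x
    rw [hx]
    simpa only [map_add, map_smul, normalProj_self he, h.normalProj_tangent he hy,
      h.normalProj_normal he hz, smul_zero, zero_add] using hz

theorem trace_tangentProj :
    LinearMap.trace ℝ E (tangentProj G e) = Module.finrank ℝ (focalTangent G e) := by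
  refine trace_eq_finrank (fun x => ?_) (fun x hx => h.tangentProj_tangent he hx)
  obtain ⟨y, hy, z, hz, hx⟩ := h.exists_decomposition he x
  rw [hx]
  simpa only [map_add, map_smul, tangentProj_self he, h.tangentProj_tangent he hy,
    h.tangentProj_normal he hz, smul_zero, zero_add, add_zero] using hy

theorem finrank_tangent_add_normal :
    1 + Module.finrank ℝ (focalTangent G e) + Module.finrank ℝ (focalNormal G e)
      = Module.finrank ℝ E := by
  have h1 := h.finrank_normal he
  have h2 := h.trace_tangentProj he
  simp only [tangentProj, map_add, map_smul, map_sub, trace_dyad, he.unit, LinearMap.trace_id,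
      smul_eq_mul] at h2
  have : (1 + Module.finrank ℝ (focalTangent G e) + Module.finrank ℝ (focalNormal G e) : ℝ)
      = Module.finrank ℝ E := by linarith
  exact_mod_cast this

section Shape

variable (hη : η ∈ focalNormal G e) (hη1 : ⟪η, η⟫ = 1)
include hη hη1

omit hη1 in
theorem trace_shapeOp :
    LinearMap.trace ℝ E (shapeOp G e η) = 3 / 2 * LinearMap.trace ℝ E (G e η) := by
  simp only [shapeOp, map_smul, map_add, trace_dyad, real_inner_comm e η, h.inner_normal he hη,
    smul_eq_mul]
  ring

/-- The trace of the square of a shape operator is determined by the Hessians at the two ends `e`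
and `η` of a normal arc, by `sq_apply_eq`. -/
theorem trace_shapeOp_sq :
    LinearMap.trace ℝ E (shapeOp G e η ∘ₗ shapeOp G e η)
      = 3 / 4 * (LinearMap.trace ℝ E (G η η) + Module.finrank ℝ (focalTangent G e) + 1 / 3
        - 1 / 3 * Module.finrank ℝ (focalNormal G e)) := by
  have hN : LinearMap.trace ℝ E (normalProj G e) = Module.finrank ℝ (focalNormal G e) := by
    rw [h.finrank_normal he]
    simp only [normalProj, map_add, map_smul, map_sub, trace_dyad, he.unit, LinearMap.trace_id,
      smul_eq_mul]
    ring
  rw [h.sq_apply_eq he hη hη1]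
  simp only [map_add, map_sub, map_smul, trace_dyad, he.unit, hη1, hN, h.trace_tangentProj he,
    smul_eq_mul]
  ring

/-- As `A³ = A`, the operator `(A² + A) / 2` is the projection onto the eigenspace of `A` for
the eigenvalue `1`. -/
theorem finrank_shape_pos : (Module.finrank ℝ (shapeSpace G e η 1) : ℝ)
    = (LinearMap.trace ℝ E (shapeOp G e η ∘ₗ shapeOp G e η)
      + LinearMap.trace ℝ E (shapeOp G e η)) / 2 := by
  rw [← trace_eq_finrank (P := (1 / 2 : ℝ) • (shapeOp G e η ∘ₗ shapeOp G e η + shapeOp G e η))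
    (fun x => ?_) (fun x hx => ?_)]
  · simp only [map_add, map_smul, smul_eq_mul]; ring
  · obtain ⟨y, hy, z, hz, hx⟩ := h.exists_decomposition he x
    have h1 := h.shapeOp_mem_tangent he hη hy
    have h2 := h.shapeOp_mem_tangent he hη h1
    rw [hx]
    simp only [map_add, map_smul, h.shapeOp_self he hη, h.shapeOp_normal he hη hz, smul_zero,
      zero_add, add_zero, LinearMap.add_apply, LinearMap.smul_apply, LinearMap.comp_apply, map_zero]
    rw [mem_shapeSpace]
    have h3 := Submodule.smul_mem _ (1 / 2 : ℝ) (Submodule.add_mem _ h2 h1)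
    refine ⟨h3, ?_⟩
    rw [← h.shapeOp_tangent he hη h3]
    simp only [map_add, map_smul, h.shapeOp_cube he hη hη1 hy]
    module
  · obtain ⟨hx1, hx2⟩ := mem_shapeSpace.1 hx
    rw [← h.shapeOp_tangent he hη hx1] at hx2
    simp only [LinearMap.add_apply, LinearMap.smul_apply, LinearMap.comp_apply, hx2, one_smul]
    module

/-- As `A³ = A`, the operator `(A² - A) / 2` is the projection onto the eigenspace of `A` for
the eigenvalue `-1`. -/
theorem finrank_shape_neg : (Module.finrank ℝ (shapeSpace G e η (-1)) : ℝ)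
    = (LinearMap.trace ℝ E (shapeOp G e η ∘ₗ shapeOp G e η)
      - LinearMap.trace ℝ E (shapeOp G e η)) / 2 := by
  rw [← trace_eq_finrank (P := (1 / 2 : ℝ) • (shapeOp G e η ∘ₗ shapeOp G e η - shapeOp G e η))
    (fun x => ?_) (fun x hx => ?_)]
  · simp only [map_sub, map_smul, smul_eq_mul]; ring
  · obtain ⟨y, hy, z, hz, hx⟩ := h.exists_decomposition he x
    have h1 := h.shapeOp_mem_tangent he hη hy
    have h2 := h.shapeOp_mem_tangent he hη h1
    rw [hx]
    simp only [map_add, map_smul, h.shapeOp_self he hη, h.shapeOp_normal he hη hz, smul_zero,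
      zero_add, add_zero, LinearMap.sub_apply, LinearMap.smul_apply, LinearMap.comp_apply, map_zero,
      sub_zero]
    rw [mem_shapeSpace]
    have h3 := Submodule.smul_mem _ (1 / 2 : ℝ) (Submodule.sub_mem _ h2 h1)
    refine ⟨h3, ?_⟩
    rw [← h.shapeOp_tangent he hη h3]
    simp only [map_sub, map_smul, h.shapeOp_cube he hη hη1 hy]
    module
  · obtain ⟨hx1, hx2⟩ := mem_shapeSpace.1 hx
    rw [← h.shapeOp_tangent he hη hx1] at hx2
    simp only [LinearMap.sub_apply, LinearMap.smul_apply, LinearMap.comp_apply, hx2, map_smul]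
    module

/-- As `A³ = A`, the kernel of `A` in the tangent space is the image of the projection `P - A²`,
where `P` is the projection onto the tangent space. -/
theorem finrank_shape_zero : (Module.finrank ℝ (shapeSpace G e η 0) : ℝ)
    = Module.finrank ℝ (focalTangent G e)
      - LinearMap.trace ℝ E (shapeOp G e η ∘ₗ shapeOp G e η) := by
  rw [← trace_eq_finrank (P := tangentProj G e - shapeOp G e η ∘ₗ shapeOp G e η)
    (fun x => ?_) (fun x hx => ?_)]
  · rw [map_sub, h.trace_tangentProj he]
  · obtain ⟨y, hy, z, hz, hx⟩ := h.exists_decomposition he x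
    have h1 := h.shapeOp_mem_tangent he hη hy
    have h2 := h.shapeOp_mem_tangent he hη h1
    rw [hx]
    simp only [map_add, map_smul, h.shapeOp_self he hη, h.shapeOp_normal he hη hz, smul_zero,
      zero_add, add_zero, LinearMap.sub_apply, LinearMap.comp_apply, map_zero, sub_zero,
      tangentProj_self he, h.tangentProj_tangent he hy, h.tangentProj_normal he hz]
    rw [mem_shapeSpace]
    have h3 := Submodule.sub_mem _ hy h2
    refine ⟨h3, ?_⟩
    rw [← h.shapeOp_tangent he hη h3]
    simp only [map_sub, h.shapeOp_cube he hη hη1 hy]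
    module
  · obtain ⟨hx1, hx2⟩ := mem_shapeSpace.1 hx
    rw [← h.shapeOp_tangent he hη hx1] at hx2
    simp only [LinearMap.sub_apply, LinearMap.comp_apply, hx2, zero_smul, map_zero, sub_zero,
      h.tangentProj_tangent he hx1]

theorem finrank_normal_orthogonal :
    Module.finrank ℝ (focalNormal G e ⊓ (ℝ ∙ η)ᗮ : Submodule ℝ E) + 1
      = Module.finrank ℝ (focalNormal G e) := by
  have hN : LinearMap.trace ℝ E (normalProj G e) = Module.finrank ℝ (focalNormal G e) := by
    rw [h.finrank_normal he]
    simp only [normalProj, map_add, map_smul, map_sub, trace_dyad, he.unit, LinearMap.trace_id,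
      smul_eq_mul]
    ring
  have : LinearMap.trace ℝ E (normalProj G e - dyad η η)
      = Module.finrank ℝ (focalNormal G e ⊓ (ℝ ∙ η)ᗮ : Submodule ℝ E) := by
    refine trace_eq_finrank (fun x => ?_) (fun x hx => ?_)
    · obtain ⟨y, hy, z, hz, hx⟩ := h.exists_decomposition he x
      have hηe : ⟪η, e⟫ = 0 := by rw [real_inner_comm, h.inner_normal he hη]
      have hηy : ⟪η, y⟫ = 0 := by rw [real_inner_comm, h.inner_tangent_normal hy hη]
      rw [hx]
      simp only [LinearMap.sub_apply, map_add, map_smul, normalProj_self he,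
        h.normalProj_tangent he hy, h.normalProj_normal he hz, dyad_apply, hηe, hηy, smul_zero,
        zero_smul, zero_add, sub_zero]
      refine ⟨Submodule.sub_mem _ hz (Submodule.smul_mem _ _ hη), ?_⟩
      rw [SetLike.mem_coe, Submodule.mem_orthogonal_singleton_iff_inner_right, inner_sub_right,
        real_inner_smul_right, hη1]
      ring
    · obtain ⟨h1, h2⟩ := hx
      rw [SetLike.mem_coe, Submodule.mem_orthogonal_singleton_iff_inner_right] at h2
      rw [LinearMap.sub_apply, h.normalProj_normal he h1, dyad_apply, h2, zero_smul, sub_zero]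
  rw [map_sub, trace_dyad, hη1, hN] at this
  have h2 : (Module.finrank ℝ (focalNormal G e ⊓ (ℝ ∙ η)ᗮ : Submodule ℝ E) : ℝ) + 1
      = Module.finrank ℝ (focalNormal G e) := by linarith
  exact_mod_cast h2

end Shape

/-- The shape operators of a focal variety of codimension at least two are traceless: the trace is
an odd continuous function on the connected unit sphere of the normal space, with integer
values. -/
theorem trace_shape_eq_zero (h2 : 2 ≤ Module.finrank ℝ (focalNormal G e))
    (hη : η ∈ focalNormal G e) (hη1 : ⟪η, η⟫ = 1) : LinearMap.trace ℝ E (G e η) = 0 := by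
  have hint : ∀ x ∈ focalNormal G e, ⟪x, x⟫ = 1 →
      ∃ m : ℤ, 3 / 2 * LinearMap.trace ℝ E (G e x) = m := by
    intro x hx hx1
    refine ⟨Module.finrank ℝ (shapeSpace G e x 1) - Module.finrank ℝ (shapeSpace G e x (-1)), ?_⟩
    push_cast
    rw [h.finrank_shape_pos he hx hx1, h.finrank_shape_neg he hx hx1, h.trace_shapeOp he hx]
    ring
  obtain ⟨ζ, hζ, hζ1, hζη⟩ : ∃ ζ ∈ focalNormal G e, ⟪ζ, ζ⟫ = 1 ∧ ⟪η, ζ⟫ = 0 := by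
    have h3 := h.finrank_normal_orthogonal he hη hη1
    have h4 : (focalNormal G e ⊓ (ℝ ∙ η)ᗮ : Submodule ℝ E) ≠ ⊥ := by
      intro h0
      rw [h0, finrank_bot] at h3
      omega
    obtain ⟨x, ⟨hx, hxη⟩, hx0⟩ := Submodule.exists_mem_ne_zero_of_ne_bot h4
    rw [SetLike.mem_coe, Submodule.mem_orthogonal_singleton_iff_inner_right] at hxη
    have hxn : ‖x‖ ≠ 0 := norm_ne_zero_iff.2 hx0
    refine ⟨‖x‖⁻¹ • x, Submodule.smul_mem _ _ hx, ?_, by rw [real_inner_smul_right, hxη, mul_zero]⟩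
    rw [real_inner_smul_left, real_inner_smul_right, real_inner_self_eq_norm_sq]
    field_simp
  -- The half circle from `η` through `ζ` to `-η` joins two points with opposite traces.
  set g : ℝ → ℝ := fun θ =>
    3 / 2 * LinearMap.trace ℝ E (G e (Real.cos θ • η + Real.sin θ • ζ)) with hg
  have hgc : ContinuousOn g Set.univ := by
    refine Continuous.continuousOn ?_
    simp only [hg, map_add, map_smul, smul_eq_mul]
    fun_prop
  have := eq_of_preconnected_of_int isPreconnected_univ hgc (fun θ _ => by
    refine hint _ (Submodule.add_mem _ (Submodule.smul_mem _ _ hη) (Submodule.smul_mem _ _ hζ)) ?_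
    simp only [inner_add_left, inner_add_right, real_inner_smul_left, real_inner_smul_right, hη1,
      hζ1, hζη, real_inner_comm η ζ]
    linear_combination Real.cos_sq_add_sin_sq θ) (Set.mem_univ 0) (Set.mem_univ Real.pi)
  simp only [hg, Real.cos_zero, Real.sin_zero, Real.cos_pi, Real.sin_pi, one_smul, zero_smul,
    add_zero, map_neg, neg_smul] at this
  linarith

end Projections

end IsEikonalForm

/-! ### Normal arcs and the Laplacian -/

/-- An eikonal quartic both of whose focal varieties have codimension at least two in the sphere,
the focal variety of the maxima being nowhere totally geodesic. -/
structure IsRegularForm {E : Type*} [NormedAddCommGroup E] [InnerProductSpace ℝ E]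
    (G : E →ₗ[ℝ] E →ₗ[ℝ] E →ₗ[ℝ] E) : Prop extends IsEikonalForm G where
  codim : ∀ e, IsFocal G e → 2 ≤ Module.finrank ℝ (focalNormal G e)
  codim_neg : ∀ e, IsFocal (-G) e → 2 ≤ Module.finrank ℝ (focalNormal (-G) e)
  shape : ∀ e, IsFocal G e → ∃ x ∈ focalNormal G e, ∃ y ∈ focalTangent G e, G e x y ≠ 0

namespace IsEikonalForm

variable {E : Type*} [NormedAddCommGroup E] [InnerProductSpace ℝ E]
  {G : E →ₗ[ℝ] E →ₗ[ℝ] E →ₗ[ℝ] E} {e η : E}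

/-- The midpoint of the normal arc from `e` to `η`, that is, of the great circle arc
`cos θ e + sin θ η`, lies on the opposite focal variety. -/
theorem isFocal_neg_midpoint (h : IsEikonalForm G) (he : IsFocal G e) (hη : η ∈ focalNormal G e)
    (hη1 : ⟪η, η⟫ = 1) {r : ℝ} (hr : 2 * r ^ 2 = 1) :
    IsFocal (-G) (r • (e + η)) ∧ r • (e - η) ∈ focalNormal (-G) (r • (e + η)) := by
  have e1 : G e e η = -η := mem_normal.1 hη
  have e2 : G e η e = -η := h.apply_normal_self hη
  have e3 : G e η η = -e := by rw [h.apply_normal_normal he hη hη, hη1, neg_one_smul]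
  have e4 : G η η η = η := (h.isFocal_normal he hη hη1).apply_self
  have e5 : G η e e = -η := by rw [h.swap₁₂, e2]
  have e6 : G η e η = -e := by rw [h.swap₁₂, e3]
  have e7 : G η η e = -e := by rw [h.swap₂₃, e6]
  have r3 : r * (r * r) = r / 2 := by linear_combination r / 2 * hr
  refine ⟨⟨?_, ?_⟩, mem_normal.2 ?_⟩
  · simp only [real_inner_smul_left, real_inner_smul_right, inner_add_left, inner_add_right,
      he.unit, hη1, h.inner_normal he hη, real_inner_comm e η]
    linear_combination hr
  · simp only [map_add, map_smul, LinearMap.add_apply, LinearMap.smul_apply, LinearMap.neg_apply,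
      he.apply_self, e1, e2, e3, e4, e5, e6, e7]
    linear_combination (norm := module) (4 * r3) • (e + η) - (2 * r3) • (e + η)
  · simp only [map_add, map_sub, map_smul, LinearMap.add_apply, LinearMap.smul_apply,
      LinearMap.neg_apply, he.apply_self, e1, e2, e3, e4, e5, e6, e7]
    linear_combination (norm := module) (-2 * r3) • (e - η)

/-- Through a point of the sphere with `-1 < f < 1` passes a great circle meeting both focal
varieties, on which the quartic is `cos 4θ`. Here `C`, `S` are the cosine and sine of `2θ`, and
`s`, `σ` those of `θ`. -/
theorem exists_focal (h : IsEikonalForm G) {x : E} {C S s σ : ℝ} (hx : ⟪x, x⟫ = 1)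
    (hc : ⟪G x x x, x⟫ = C ^ 2 - S ^ 2) (hC : 0 < C) (hS : 0 < S) (h1 : C ^ 2 + S ^ 2 = 1)
    (h2 : s ^ 2 - σ ^ 2 = C) (h3 : 2 * s * σ = S) (h4 : s ^ 2 + σ ^ 2 = 1) :
    ∃ e η, IsFocal G e ∧ η ∈ focalNormal G e ∧ ⟪η, η⟫ = 1 ∧ x = s • e + σ • η ∧
      G x x x = (C ^ 2 - S ^ 2) • x + (2 * S * C) • (σ • e - s • η) := by
  set c := C ^ 2 - S ^ 2 with hcdef
  set d := 2 * S * C with hddef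
  have hd : 0 < d := by positivity
  have hcd : c ^ 2 + d ^ 2 = 1 := by
    rw [hcdef, hddef]; linear_combination (C ^ 2 + S ^ 2 + 1) * h1
  -- The great circle is tangent to the gradient: with `c = cos 4θ` and `d = sin 4θ`, the gradient
  -- is `4 (c x + d N)`. The eikonal identities determine the quartic on the plane of `x` and `N`.
  set N := d⁻¹ • (G x x x - c • x) with hN
  have hdN : G x x x = c • x + d • N := by
    rw [hN, smul_inv_smul₀ hd.ne']; abel
  have hc' : ⟪x, G x x x⟫ = c := by rw [real_inner_comm, hc]
  have hxN : ⟪x, N⟫ = 0 := by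
    rw [hN, real_inner_smul_right, inner_sub_right, hc', real_inner_smul_right, hx]; ring
  have hNx : ⟪N, x⟫ = 0 := by rw [real_inner_comm, hxN]
  have hNN : ⟪N, N⟫ = 1 := by
    have := h.eikonal x
    rw [hx, hdN] at this
    simp only [inner_add_left, inner_add_right, real_inner_smul_left, real_inner_smul_right, hx,
      hxN, hNx] at this
    have h5 : d ^ 2 * (⟪N, N⟫ - 1) = 0 := by linear_combination this - hcd
    rcases mul_eq_zero.1 h5 with h6 | h6
    · exact absurd h6 (by positivity)
    · linarith
  have hxxN : G x x N = d • x - c • N := by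
    have h5 : G x x (G x x x) = x := by
      refine ext_inner_right ℝ fun y => ?_
      rw [h.inner_swap, real_inner_comm, (h.polarised x y).1, hx]; ring
    rw [hdN, map_add, map_smul, map_smul, hdN] at h5
    have h6 : d • (G x x N - (d • x - c • N)) = 0 := by
      linear_combination (norm := module) h5 - hcd • x
    rcases smul_eq_zero.1 h6 with h7 | h7
    · exact absurd h7 hd.ne'
    · exact sub_eq_zero.1 h7
  have t1 : ⟪G x x x, N⟫ = d := by
    rw [hdN, inner_add_left, real_inner_smul_left, real_inner_smul_left, hxN, hNN]; ring
  have t2 : ⟪G x x N, x⟫ = d := by rw [h.inner_swap, t1]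
  have t3 : ⟪G x x N, N⟫ = -c := by
    rw [hxxN, inner_sub_left, real_inner_smul_left, real_inner_smul_left, hxN, hNN]; ring
  have t4 : ⟪G x N N, x⟫ = -c := by rw [h.inner_swap, h.swap₂₃, t3]
  have k2 := (h.polarised x N).2.1
  have k3 := (h.polarised x N).2.2
  have t5 : ⟪G x N N, N⟫ = -d := by
    rw [hxxN, hdN, hx, hxN, hNN] at k2
    simp only [inner_add_left, inner_sub_left, inner_sub_right, real_inner_smul_left,
      real_inner_smul_right, hx, hxN, hNx, hNN, real_inner_comm (G x N N) x,
      real_inner_comm (G x N N) N, t4] at k2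
    have h5 : d * (⟪G x N N, N⟫ + d) = 0 := by linear_combination k2 / 2 - hcd / 2
    rcases mul_eq_zero.1 h5 with h6 | h6
    · exact absurd h6 hd.ne'
    · linarith
  have t6 : ⟪G N N N, x⟫ = -d := by rw [h.inner_swap₁, t5]
  have t7 : ⟪G N N N, N⟫ = c := by
    rw [hxxN, hdN, hx, hxN, hNN] at k3
    simp only [inner_add_left, inner_sub_left, real_inner_smul_left, real_inner_comm (G x N N) x,
      real_inner_comm (G x N N) N, real_inner_comm (G N N N) x, real_inner_comm (G N N N) N,
      t4, t5, t6] at k3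
    have h5 : d * (⟪G N N N, N⟫ - c) = 0 := by linear_combination k3 / 2
    rcases mul_eq_zero.1 h5 with h6 | h6
    · exact absurd h6 hd.ne'
    · linarith
  have hfe : c * (s ^ 4 - 6 * s ^ 2 * σ ^ 2 + σ ^ 4) + d * (4 * s * σ * (s ^ 2 - σ ^ 2)) = 1 := by
    have h5 : s ^ 4 - 6 * s ^ 2 * σ ^ 2 + σ ^ 4 = c := by rw [hcdef, ← h2, ← h3]; ring
    have h6 : 4 * s * σ * (s ^ 2 - σ ^ 2) = d := by rw [hddef, ← h2, ← h3]; ring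
    rw [h5, h6]; linear_combination hcd
  have heu : ⟪s • x + σ • N, s • x + σ • N⟫ = 1 := by
    simp only [inner_add_left, inner_add_right, real_inner_smul_left, real_inner_smul_right, hx,
      hxN, hNx, hNN]
    linear_combination h4
  have hηu : ⟪σ • x - s • N, σ • x - s • N⟫ = 1 := by
    simp only [inner_sub_left, inner_sub_right, real_inner_smul_left, real_inner_smul_right, hx,
      hxN, hNx, hNN]
    linear_combination h4
  have heη : ⟪s • x + σ • N, σ • x - s • N⟫ = 0 := by
    simp only [inner_add_left, inner_sub_right, real_inner_smul_left, real_inner_smul_right, hx,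
      hxN, hNx, hNN]
    ring
  have p1 : G x N x = G x x N := h.swap₂₃ _ _ _
  have p2 : G N x x = G x x N := by rw [h.swap₁₂, p1]
  have p3 : G N x N = G x N N := h.swap₁₂ _ _ _
  have p4 : G N N x = G x N N := by rw [h.swap₂₃, p3]
  have hef : IsFocal G (s • x + σ • N) := by
    refine ⟨heu, ?_⟩
    rw [h.apply_eq_of_quartic, heu, one_smul]
    rw [heu]
    simp only [map_add, map_smul, LinearMap.add_apply, LinearMap.smul_apply, p1, p2, p3, p4,
      inner_add_left, inner_add_right, real_inner_smul_left, real_inner_smul_right, hc, t1, t2, t3,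
      t4, t5, t6, t7]
    linear_combination hfe
  refine ⟨_, σ • x - s • N, hef, mem_normal.2 ?_, hηu, ?_, ?_⟩
  · have q1 := h.hessian_quadratic hef heη
    have q2 : ⟪G (s • x + σ • N) (s • x + σ • N) (σ • x - s • N), σ • x - s • N⟫ = -1 := by
      simp only [map_add, map_sub, map_smul, LinearMap.add_apply, LinearMap.smul_apply, p1, p2, p3,
        p4, inner_add_left, inner_sub_left, inner_sub_right, real_inner_smul_left,
        real_inner_smul_right, hc, t1, t2, t3, t4, t5, t6, t7]
      linear_combination -hfe
    apply eq_of_inner_self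
    · rw [inner_neg_neg, hηu]
      rw [q2, hηu] at q1
      linarith
    · rw [inner_neg_right, inner_neg_neg, q2, hηu, neg_neg]
  · linear_combination (norm := module) -h4 • x
  · rw [hdN]
    linear_combination (norm := module) (-d * h4) • N

end IsEikonalForm

/-- Cosines and sines of `2θ` and `θ`, for the angle `θ` between `0` and `π / 4` with
`cos 4θ = c`. -/
theorem exists_angle {c : ℝ} (hc : c ∈ Set.Ioo (-1 : ℝ) 1) : ∃ C S s σ : ℝ, 0 < C ∧ 0 < S ∧
    C ^ 2 - S ^ 2 = c ∧ C ^ 2 + S ^ 2 = 1 ∧ s ^ 2 - σ ^ 2 = C ∧ 2 * s * σ = S ∧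
      s ^ 2 + σ ^ 2 = 1 := by
  obtain ⟨h1, h2⟩ := hc
  have hC : √((1 + c) / 2) ^ 2 = (1 + c) / 2 := Real.sq_sqrt (by linarith)
  have hS : √((1 - c) / 2) ^ 2 = (1 - c) / 2 := Real.sq_sqrt (by linarith)
  have hC0 : 0 < √((1 + c) / 2) := Real.sqrt_pos.2 (by linarith)
  have hS0 : 0 < √((1 - c) / 2) := Real.sqrt_pos.2 (by linarith)
  set C := √((1 + c) / 2)
  set S := √((1 - c) / 2)
  have hC1 : C ≤ 1 := by nlinarith
  have hs : √((1 + C) / 2) ^ 2 = (1 + C) / 2 := Real.sq_sqrt (by linarith)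
  have hσ : √((1 - C) / 2) ^ 2 = (1 - C) / 2 := Real.sq_sqrt (by linarith)
  refine ⟨C, S, √((1 + C) / 2), √((1 - C) / 2), hC0, hS0, by linarith, by linarith, by linarith,
    ?_, by linarith⟩
  refine (pow_left_inj₀ (by positivity) hS0.le two_ne_zero).1 ?_
  rw [mul_pow, mul_pow, hs, hσ]
  linear_combination -hC - hS

theorem continuous_diagonal {E F : Type*} [NormedAddCommGroup E] [NormedSpace ℝ E]
    [FiniteDimensional ℝ E] [NormedAddCommGroup F] [NormedSpace ℝ F]
    (B : E →ₗ[ℝ] E →ₗ[ℝ] F) : Continuous fun x => B x x := by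
  have h1 : Continuous (LinearMap.toContinuousLinearMap.toLinearMap ∘ₗ B : E →ₗ[ℝ] E →L[ℝ] F) :=
    LinearMap.continuous_of_finiteDimensional _
  exact h1.clm_apply continuous_id

namespace IsRegularForm

variable {E : Type*} [NormedAddCommGroup E] [InnerProductSpace ℝ E] [FiniteDimensional ℝ E]
  {G : E →ₗ[ℝ] E →ₗ[ℝ] E →ₗ[ℝ] E} {e η : E}

/-- The two ends of a normal arc have the same Laplacian: the mixed trace vanishes at the
midpoint, which is a focal point of the opposite quartic. -/
theorem trace_normal_eq (h : IsRegularForm G) (he : IsFocal G e) (hη : η ∈ focalNormal G e)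
    (hη1 : ⟪η, η⟫ = 1) :
    LinearMap.trace ℝ E (G η η) = LinearMap.trace ℝ E (G e e) := by
  have hr : 2 * (√2)⁻¹ ^ 2 = (1 : ℝ) := by
    rw [inv_pow, Real.sq_sqrt (by norm_num)]; norm_num
  obtain ⟨hm, hζ⟩ := h.isFocal_neg_midpoint he hη hη1 hr
  have hηe : ⟪η, e⟫ = 0 := by rw [real_inner_comm, h.inner_normal he hη]
  have := h.toIsEikonalForm.neg.trace_shape_eq_zero hm (h.codim_neg _ hm) hζ (by
    simp only [real_inner_smul_left, real_inner_smul_right, inner_sub_left, inner_sub_right,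
      he.unit, hη1, h.inner_normal he hη, hηe]
    linear_combination hr)
  have hsw : G η e = G e η := LinearMap.ext fun z => h.swap₁₂ _ _ _
  simp only [map_smul, map_add, map_sub, LinearMap.smul_apply, LinearMap.add_apply,
    LinearMap.neg_apply, map_neg, smul_eq_mul, hsw] at this
  linear_combination 2 * this + (LinearMap.trace ℝ E (G e e) - LinearMap.trace ℝ E (G η η)) * hr

/-- The Laplacian of a regular eikonal quartic is a multiple of `|x|²`: on the unit sphere it is
continuous with integral values, up to a factor. -/
theorem trace_eq (h : IsRegularForm G) (he : IsFocal G e) (x : E) :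
    LinearMap.trace ℝ E (G x x) = ⟪x, x⟫ * LinearMap.trace ℝ E (G e e) := by
  have hfocal : ∀ {G' : E →ₗ[ℝ] E →ₗ[ℝ] E →ₗ[ℝ] E} {e' : E}, IsEikonalForm G' → IsFocal G' e' →
      ∃ m : ℤ, 3 * LinearMap.trace ℝ E (G' e' e') = m := by
    intro G' e' h' he'
    have := h'.finrank_normal he'
    refine ⟨Module.finrank ℝ E + 2 - 4 * Module.finrank ℝ (focalNormal G' e'), ?_⟩
    push_cast
    linarith
  -- At focal points of either kind the trace is given by the dimension of the normal space; any
  -- other point lies on a normal arc, along which the trace is constant.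
  have hint : ∀ y ∈ Metric.sphere (0 : E) 1, ∃ m : ℤ, 3 * LinearMap.trace ℝ E (G y y) = m := by
    intro y hy
    rw [mem_sphere_zero_iff_norm] at hy
    have hy1 : ⟪y, y⟫ = 1 := by rw [real_inner_self_eq_norm_sq, hy, one_pow]
    have hle := h.quartic_le hy1
    by_cases h1 : ⟪G y y y, y⟫ = 1
    · refine hfocal h.toIsEikonalForm ⟨hy1, ?_⟩
      rw [h.apply_eq_of_quartic (by rw [h1, hy1, one_pow]), hy1, one_smul]
    by_cases h2 : ⟪G y y y, y⟫ = -1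
    · obtain ⟨m, hm⟩ := hfocal (e' := y) h.toIsEikonalForm.neg ⟨hy1, by
        rw [h.toIsEikonalForm.neg.apply_eq_of_quartic, hy1, one_smul]
        simp only [LinearMap.neg_apply, inner_neg_left, h2, hy1]
        norm_num⟩
      refine ⟨-m, ?_⟩
      simp only [LinearMap.neg_apply, map_neg] at hm
      push_cast
      linarith
    · obtain ⟨C, S, s, σ, hC, hS, hc, hCS, hs1, hs2, hs3⟩ := exists_angle
        (c := ⟪G y y y, y⟫) ⟨lt_of_le_of_ne (by nlinarith) (Ne.symm h2),
          lt_of_le_of_ne (by nlinarith) h1⟩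
      obtain ⟨a, ζ, ha, hζ, hζ1, hyy, -⟩ := h.exists_focal hy1 hc.symm hC hS hCS hs1 hs2 hs3
      obtain ⟨m, hm⟩ := hfocal h.toIsEikonalForm ha
      refine ⟨m, ?_⟩
      rw [← hm, hyy]
      have hsw : G ζ a = G a ζ := LinearMap.ext fun z => h.swap₁₂ _ _ _
      simp only [map_smul, map_add, LinearMap.smul_apply, LinearMap.add_apply, smul_eq_mul, hsw,
        h.trace_normal_eq ha hζ hζ1, h.trace_shape_eq_zero ha (h.codim a ha) hζ hζ1]
      linear_combination 3 * LinearMap.trace ℝ E (G a a) * hs3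
  have hrank : 1 < Module.rank ℝ E := by
    rw [← Module.finrank_eq_rank]
    have h1 := h.finrank_tangent_add_normal he
    have h2 := h.codim e he
    exact_mod_cast (by omega : 1 < Module.finrank ℝ E)
  have hcont : Continuous fun y => 3 * LinearMap.trace ℝ E (G y y) :=
    continuous_const.mul (continuous_diagonal (G.compr₂ (LinearMap.trace ℝ E)))
  have hunit : ∀ y : E, ‖y‖ = 1 → LinearMap.trace ℝ E (G y y) = LinearMap.trace ℝ E (G e e) := by
    intro y hy
    have he1 : ‖e‖ = 1 := by
      have := he.unit
      rw [real_inner_self_eq_norm_sq] at this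
      nlinarith [norm_nonneg e]
    have := eq_of_preconnected_of_int (isPreconnected_sphere hrank (0 : E) 1)
      hcont.continuousOn hint
      (mem_sphere_zero_iff_norm.2 hy) (mem_sphere_zero_iff_norm.2 he1)
    linarith
  rcases eq_or_ne x 0 with rfl | hx
  · simp
  have hxn : ‖x‖ ≠ 0 := norm_ne_zero_iff.2 hx
  have := hunit (‖x‖⁻¹ • x) (by rw [norm_smul, norm_inv, norm_norm, inv_mul_cancel₀ hxn])
  simp only [map_smul, LinearMap.smul_apply, smul_eq_mul] at this
  rw [← this, real_inner_self_eq_norm_sq]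
  field_simp

/-- The dimensions attached to a regular eikonal quartic. The constant Laplacian fixes the
dimension `q` of the normal spaces and the trace of the squared shape operators, and these are
traceless, so that the eigenvalues `1` and `-1` have the same multiplicity `ν`, independent of all
choices. -/
theorem multiplicities (h : IsRegularForm G) (hne : ∃ e, IsFocal G e) :
    ∃ q ν : ℕ, 2 ≤ q ∧ 1 ≤ ν ∧ Module.finrank ℝ E = 2 * (q - 1 + ν) + 2 ∧
      (∀ x, LinearMap.trace ℝ E (G x x) = 2 / 3 * ((ν : ℝ) - (q - 1 : ℕ)) * ⟪x, x⟫) ∧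
      ∀ e, IsFocal G e → Module.finrank ℝ (focalNormal G e) = q ∧
        Module.finrank ℝ (focalTangent G e) = q - 1 + 2 * ν ∧
        ∀ η ∈ focalNormal G e, ⟪η, η⟫ = 1 →
          Module.finrank ℝ (shapeSpace G e η 1) = ν ∧
          Module.finrank ℝ (shapeSpace G e η (-1)) = ν ∧
          Module.finrank ℝ (shapeSpace G e η 0) = q - 1 ∧
          Module.finrank ℝ (focalNormal G e ⊓ (ℝ ∙ η)ᗮ : Submodule ℝ E) = q - 1 := by
  obtain ⟨e₀, he₀⟩ := hne
  set q := Module.finrank ℝ (focalNormal G e₀) with hq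
  have hq2 : 2 ≤ q := h.codim e₀ he₀
  have hq1 : ((q - 1 : ℕ) : ℝ) = q - 1 := by push_cast [show 1 ≤ q by omega]; ring
  have hqe : ∀ e, IsFocal G e → Module.finrank ℝ (focalNormal G e) = q := by
    intro e he
    have h1 := h.finrank_normal he
    have h2 := h.finrank_normal he₀
    rw [h.trace_eq he₀ e, he.unit, one_mul, ← h2] at h1
    exact_mod_cast h1
  have hsq : ∀ e η, IsFocal G e → η ∈ focalNormal G e → ⟪η, η⟫ = 1 →
      LinearMap.trace ℝ E (shapeOp G e η ∘ₗ shapeOp G e η) = Module.finrank ℝ E - 2 * q := by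
    intro e η he hη hη1
    have h1 := h.finrank_normal he
    have h2 : (1 + Module.finrank ℝ (focalTangent G e) + Module.finrank ℝ (focalNormal G e) : ℝ)
      = Module.finrank ℝ E := by exact_mod_cast h.finrank_tangent_add_normal he
    have h3 := h.trace_shapeOp_sq he hη hη1
    rw [h.trace_normal_eq he hη hη1] at h3
    rw [hqe e he] at h1 h2 h3
    linarith
  have htr : ∀ e η, IsFocal G e → η ∈ focalNormal G e → ⟪η, η⟫ = 1 →
      LinearMap.trace ℝ E (shapeOp G e η) = 0 := by
    intro e η he hη hη1
    rw [h.trace_shapeOp he hη, h.trace_shape_eq_zero he (h.codim e he) hη hη1, mul_zero]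
  -- a point and a normal direction with nonzero shape operator
  obtain ⟨η₀, hη₀, hη₀1, y₀, hy₀, hne₀⟩ : ∃ η ∈ focalNormal G e₀, ⟪η, η⟫ = 1 ∧
      ∃ y ∈ focalTangent G e₀, G e₀ η y ≠ 0 := by
    obtain ⟨x, hx, y, hy, hxy⟩ := h.shape e₀ he₀
    have hx0 : x ≠ 0 := by rintro rfl; simp at hxy
    have hxn : ‖x‖ ≠ 0 := norm_ne_zero_iff.2 hx0
    refine ⟨‖x‖⁻¹ • x, Submodule.smul_mem _ _ hx, ?_, y, hy, ?_⟩
    · rw [real_inner_smul_left, real_inner_smul_right, real_inner_self_eq_norm_sq]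
      field_simp
    · rw [map_smul, LinearMap.smul_apply]
      exact smul_ne_zero (inv_ne_zero hxn) hxy
  set ν := Module.finrank ℝ (shapeSpace G e₀ η₀ 1) with hν
  have hνq : (2 * ν : ℝ) = Module.finrank ℝ E - 2 * q := by
    have h1 := h.finrank_shape_pos he₀ hη₀ hη₀1
    rw [hsq _ _ he₀ hη₀ hη₀1, htr _ _ he₀ hη₀ hη₀1] at h1
    linarith
  have hn : Module.finrank ℝ E = 2 * ν + 2 * q := by
    have : (Module.finrank ℝ E : ℝ) = 2 * ν + 2 * q := by linarith
    exact_mod_cast this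
  -- If `1`, and hence also `-1`, were not an eigenvalue, the shape operator would vanish.
  have hν1 : 1 ≤ ν := by
    by_contra h0
    have hν0 : ν = 0 := by omega
    have hpos : shapeSpace G e₀ η₀ 1 = ⊥ := Submodule.finrank_eq_zero.1 (hν ▸ hν0)
    have hneg : shapeSpace G e₀ η₀ (-1) = ⊥ := by
      apply Submodule.finrank_eq_zero.1
      have h1 := h.finrank_shape_neg he₀ hη₀ hη₀1
      rw [hsq _ _ he₀ hη₀ hη₀1, htr _ _ he₀ hη₀ hη₀1, ← hνq, hν0] at h1
      have h2 : (Module.finrank ℝ (shapeSpace G e₀ η₀ (-1)) : ℝ) = (0 : ℕ) := by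
        rw [h1]; norm_num
      exact_mod_cast h2
    have h3 := h.shape_cube he₀ hη₀ hη₀1 hy₀
    have m1 := h.apply_normal_tangent he₀ hη₀ hy₀
    have m2 := h.apply_normal_tangent he₀ hη₀ m1
    have u1 : (2 : ℝ) • G e₀ η₀ y₀ + (3 : ℝ) • G e₀ η₀ (G e₀ η₀ y₀) = 0 := by
      rw [← Submodule.mem_bot ℝ, ← hpos, IsEikonalForm.mem_shapeSpace]
      refine ⟨Submodule.add_mem _ (Submodule.smul_mem _ _ m1) (Submodule.smul_mem _ _ m2), ?_⟩
      simp only [map_add, map_smul]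
      linear_combination (norm := module) (1 / 2 : ℝ) • h3
    have u2 : (2 : ℝ) • G e₀ η₀ y₀ - (3 : ℝ) • G e₀ η₀ (G e₀ η₀ y₀) = 0 := by
      rw [← Submodule.mem_bot ℝ, ← hneg, IsEikonalForm.mem_shapeSpace]
      refine ⟨Submodule.sub_mem _ (Submodule.smul_mem _ _ m1) (Submodule.smul_mem _ _ m2), ?_⟩
      simp only [map_sub, map_smul]
      linear_combination (norm := module) (-1 / 2 : ℝ) • h3
    apply hne₀
    linear_combination (norm := module) (1 / 4 : ℝ) • u1 + (1 / 4 : ℝ) • u2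
  -- It remains to read off the Laplacian and, at any focal point, the multiplicities.
  refine ⟨q, ν, hq2, hν1, by omega, fun x => ?_, fun e he => ⟨hqe e he, ?_, ?_⟩⟩
  · have h2 := h.finrank_normal he₀
    have hn' : (Module.finrank ℝ E : ℝ) = 2 * ν + 2 * q := by linarith
    rw [← hq, hn'] at h2
    rw [h.trace_eq he₀ x, hq1]
    have h3 : LinearMap.trace ℝ E (G e₀ e₀) = 2 / 3 * ((ν : ℝ) - (q - 1)) := by linarith
    rw [h3]; ring
  · have := h.finrank_tangent_add_normal he
    rw [hqe e he] at this
    omega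
  · intro η hη hη1
    have hL : (Module.finrank ℝ (focalTangent G e) : ℝ) = Module.finrank ℝ E - 1 - q := by
      have : (1 + Module.finrank ℝ (focalTangent G e) + Module.finrank ℝ (focalNormal G e) : ℝ)
        = Module.finrank ℝ E := by exact_mod_cast h.finrank_tangent_add_normal he
      rw [hqe e he] at this
      linarith
    have h1 := h.finrank_shape_pos he hη hη1
    have h2 := h.finrank_shape_neg he hη hη1
    have h3 := h.finrank_shape_zero he hη hη1
    have h4 := h.finrank_normal_orthogonal he hη hη1
    rw [hsq _ _ he hη hη1, ← hνq] at h1 h2 h3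
    rw [htr _ _ he hη hη1] at h1 h2
    rw [hqe e he] at h4
    refine ⟨?_, ?_, ?_, by omega⟩
    · have : (Module.finrank ℝ (shapeSpace G e η 1) : ℝ) = ν := by rw [h1]; ring
      exact_mod_cast this
    · have : (Module.finrank ℝ (shapeSpace G e η (-1)) : ℝ) = ν := by rw [h2]; ring
      exact_mod_cast this
    · have : (Module.finrank ℝ (shapeSpace G e η 0) : ℝ) = (q - 1 : ℕ) := by
        rw [h3, hL, hq1]; linarith
      exact_mod_cast this

end IsRegularForm

/-! ### Polarisation and differentiation of a quartic polynomial -/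

section Polarisation

open MvPolynomial

theorem pderiv_comm {σ : Type*} (i j : σ) (f : MvPolynomial σ ℝ) :
    pderiv i (pderiv j f) = pderiv j (pderiv i f) := by
  classical
  have h : ⁅(pderiv i : Derivation ℝ (MvPolynomial σ ℝ) (MvPolynomial σ ℝ)),
      (pderiv j : Derivation ℝ (MvPolynomial σ ℝ) (MvPolynomial σ ℝ))⁆ = 0 := by
    apply MvPolynomial.derivation_ext
    intro k
    rw [Derivation.commutator_apply, pderiv_X, pderiv_X]
    simp only [Pi.single_apply]
    split_ifs <;> simp
  have := DFunLike.congr_fun h f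
  rw [Derivation.commutator_apply] at this
  exact sub_eq_zero.1 this

/-- The coefficients of the symmetric four-linear form of a quartic: its fourth partial
derivatives, which are constants, divided by `4!`. -/
noncomputable def quarticCoeff {n : ℕ} (f : MvPolynomial (Fin n) ℝ) (i j k l : Fin n) : ℝ :=
  coeff 0 (pderiv l (pderiv k (pderiv j (pderiv i f)))) / 24

/-- The identity of Euler, solved for the value of the polynomial. -/
theorem eval_eq_sum_pderiv {n d : ℕ} {f : MvPolynomial (Fin n) ℝ} (hf : f.IsHomogeneous d)
    (hd : d ≠ 0) (x : Fin n → ℝ) :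
    eval x f = ∑ i, x i * eval x (pderiv i f) / d := by
  have h := congrArg (eval x) hf.sum_X_mul_pderiv
  simp only [map_sum, map_mul, eval_X, nsmul_eq_mul, map_natCast] at h
  have hd' : (d : ℝ) ≠ 0 := by exact_mod_cast hd
  rw [← Finset.sum_div, h]
  field_simp

theorem eval_eq_quarticCoeff {n : ℕ} {f : MvPolynomial (Fin n) ℝ} (hf : f.IsHomogeneous 4)
    (x : Fin n → ℝ) :
    eval x f = ∑ i, ∑ j, ∑ k, ∑ l, quarticCoeff f i j k l * (x i * x j * x k * x l) := by
  rw [eval_eq_sum_pderiv hf (by norm_num)]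
  refine Finset.sum_congr rfl fun i _ => ?_
  have h1 : (pderiv i f).IsHomogeneous 3 := hf.pderiv
  rw [eval_eq_sum_pderiv h1 (by norm_num), Finset.mul_sum, Finset.sum_div]
  refine Finset.sum_congr rfl fun j _ => ?_
  have h2 : (pderiv j (pderiv i f)).IsHomogeneous 2 := h1.pderiv
  rw [eval_eq_sum_pderiv h2 (by norm_num), Finset.mul_sum, Finset.sum_div, Finset.mul_sum,
    Finset.sum_div]
  refine Finset.sum_congr rfl fun k _ => ?_
  have h3 : (pderiv k (pderiv j (pderiv i f))).IsHomogeneous 1 := h2.pderiv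
  rw [eval_eq_sum_pderiv h3 (by norm_num), Finset.mul_sum, Finset.sum_div, Finset.mul_sum,
    Finset.sum_div, Finset.mul_sum, Finset.sum_div]
  refine Finset.sum_congr rfl fun l _ => ?_
  have h4 : (pderiv l (pderiv k (pderiv j (pderiv i f)))).IsHomogeneous 0 := h3.pderiv
  rw [← totalDegree_zero_iff_isHomogeneous, totalDegree_eq_zero_iff_eq_C] at h4
  rw [quarticCoeff, h4, eval_C, coeff_C, if_pos rfl]
  push_cast
  ring

/-- The symmetric trilinear map `G` with `f x = ⟪G x x x, x⟫`. -/
noncomputable def polarForm {n : ℕ} (f : MvPolynomial (Fin n) ℝ) :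
    Euc n →ₗ[ℝ] Euc n →ₗ[ℝ] Euc n →ₗ[ℝ] Euc n :=
  ∑ i, ∑ j, ∑ k, ∑ l, (EuclideanSpace.proj (𝕜 := ℝ) i).toLinearMap.smulRight
    ((EuclideanSpace.proj (𝕜 := ℝ) j).toLinearMap.smulRight
      ((EuclideanSpace.proj (𝕜 := ℝ) k).toLinearMap.smulRight
        (quarticCoeff f i j k l • EuclideanSpace.single l (1 : ℝ))))

theorem inner_polarForm {n : ℕ} (f : MvPolynomial (Fin n) ℝ) (x y z w : Euc n) :
    ⟪polarForm f x y z, w⟫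
      = ∑ i, ∑ j, ∑ k, ∑ l, quarticCoeff f i j k l * (x i * y j * z k * w l) := by
  simp only [polarForm, LinearMap.sum_apply, LinearMap.smulRight_apply, LinearMap.smul_apply,
    sum_inner, real_inner_smul_left, EuclideanSpace.inner_single_left,
    ContinuousLinearMap.coe_coe, PiLp.proj_apply]
  refine Finset.sum_congr rfl fun i _ => Finset.sum_congr rfl fun j _ =>
    Finset.sum_congr rfl fun k _ => Finset.sum_congr rfl fun l _ => ?_
  simp
  ring

theorem polarForm_swap₁₂ {n : ℕ} (f : MvPolynomial (Fin n) ℝ) (x y z : Euc n) :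
    polarForm f x y z = polarForm f y x z := by
  refine ext_inner_right ℝ fun w => ?_
  rw [inner_polarForm, inner_polarForm, Finset.sum_comm]
  refine Finset.sum_congr rfl fun i _ => Finset.sum_congr rfl fun j _ =>
    Finset.sum_congr rfl fun k _ => Finset.sum_congr rfl fun l _ => ?_
  rw [quarticCoeff, quarticCoeff, pderiv_comm i j]
  ring

theorem polarForm_swap₂₃ {n : ℕ} (f : MvPolynomial (Fin n) ℝ) (x y z : Euc n) :
    polarForm f x y z = polarForm f x z y := by
  refine ext_inner_right ℝ fun w => ?_
  rw [inner_polarForm, inner_polarForm]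
  refine Finset.sum_congr rfl fun i _ => ?_
  rw [Finset.sum_comm]
  refine Finset.sum_congr rfl fun j _ =>
    Finset.sum_congr rfl fun k _ => Finset.sum_congr rfl fun l _ => ?_
  rw [quarticCoeff, quarticCoeff, pderiv_comm j k]
  ring

theorem inner_polarForm_swap {n : ℕ} (f : MvPolynomial (Fin n) ℝ) (x y z w : Euc n) :
    ⟪polarForm f x y z, w⟫ = ⟪polarForm f x y w, z⟫ := by
  rw [inner_polarForm, inner_polarForm]
  refine Finset.sum_congr rfl fun i _ => Finset.sum_congr rfl fun j _ => ?_
  rw [Finset.sum_comm]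
  refine Finset.sum_congr rfl fun k _ => Finset.sum_congr rfl fun l _ => ?_
  rw [quarticCoeff, quarticCoeff, pderiv_comm k l]
  ring

theorem polyFun_eq {n : ℕ} {f : MvPolynomial (Fin n) ℝ} (hf : f.IsHomogeneous 4) (x : Euc n) :
    polyFun f x = ⟪polarForm f x x x, x⟫ := by
  rw [inner_polarForm, polyFun, eval_eq_quarticCoeff hf]

end Polarisation

section Derivatives

variable {n : ℕ} {f : MvPolynomial (Fin n) ℝ}

theorem hasFDerivAt_cube (f : MvPolynomial (Fin n) ℝ) (x : Euc n) :
    HasFDerivAt (fun y => polarForm f y y y)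
      ((3 : ℝ) • LinearMap.toContinuousLinearMap (polarForm f x x)) x := by
  let L₁ : Euc n →ₗ[ℝ] Euc n →ₗ[ℝ] Euc n →L[ℝ] Euc n :=
    (polarForm f).compr₂ LinearMap.toContinuousLinearMap.toLinearMap
  let L₂ : Euc n →ₗ[ℝ] Euc n →L[ℝ] Euc n →L[ℝ] Euc n :=
    LinearMap.toContinuousLinearMap.toLinearMap ∘ₗ L₁
  set B : Euc n →L[ℝ] Euc n →L[ℝ] Euc n →L[ℝ] Euc n :=
    ⟨L₂, LinearMap.continuous_of_finiteDimensional (F' := Euc n →L[ℝ] Euc n →L[ℝ] Euc n) L₂⟩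
  have hB : ∀ a b c, B a b c = polarForm f a b c := fun a b c => rfl
  have h1 := (B.hasFDerivAt (x := x)).clm_apply (hasFDerivAt_id x)
  have h2 := h1.clm_apply (hasFDerivAt_id x)
  refine HasFDerivAt.congr_fderiv h2 ?_
  ext1 v
  simp only [add_apply, ContinuousLinearMap.comp_apply,
    ContinuousLinearMap.flip_apply, smul_apply, ContinuousLinearMap.id_apply,
    id, hB, LinearMap.coe_toContinuousLinearMap']
  rw [polarForm_swap₂₃ f x v x, polarForm_swap₁₂ f v x x, polarForm_swap₂₃ f x v x]
  module

theorem hasGradientAt_polyFun (hf : f.IsHomogeneous 4) (x : Euc n) :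
    HasGradientAt (polyFun f) ((4 : ℝ) • polarForm f x x x) x := by
  rw [hasGradientAt_iff_hasFDerivAt]
  have h1 := (hasFDerivAt_cube f x).inner ℝ (hasFDerivAt_id x)
  have h2 : polyFun f = fun y => ⟪polarForm f y y y, id y⟫ := funext fun y => polyFun_eq hf y
  rw [h2]
  refine HasFDerivAt.congr_fderiv h1 ?_
  ext1 v
  have := inner_polarForm_swap f x x v x
  simp [fderivInnerCLM_apply, this, real_inner_smul_left]
  ring

theorem gradient_polyFun (hf : f.IsHomogeneous 4) (x : Euc n) :
    ∇ (polyFun f) x = (4 : ℝ) • polarForm f x x x :=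
  (hasGradientAt_polyFun hf x).gradient

theorem isEikonalForm_iff (hf : f.IsHomogeneous 4) :
    IsEikonalForm (polarForm f) ↔ IsEikonalQuartic f := by
  have key : ∀ x : Euc n, ⟪polarForm f x x x, polarForm f x x x⟫ = ⟪x, x⟫ ^ 3 ↔
      ‖∇ (polyFun f) x‖ ^ 2 = 16 * ‖x‖ ^ 6 := by
    intro x
    rw [gradient_polyFun hf, norm_smul, real_inner_self_eq_norm_sq, real_inner_self_eq_norm_sq]
    norm_num
    constructor <;> intro h <;> linarith
  exact ⟨fun h => ⟨hf, fun x => (key x).1 (h.eikonal x)⟩, fun h =>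
    ⟨polarForm_swap₁₂ f, polarForm_swap₂₃ f, inner_polarForm_swap f, fun x => (key x).2 (h.2 x)⟩⟩

theorem laplacian_polyFun (hf : f.IsHomogeneous 4) (x : Euc n) :
    Laplacian.laplacian (polyFun f) x = 12 * LinearMap.trace ℝ (Euc n) (polarForm f x x) := by
  have h1 : fderiv ℝ (polyFun f) = fun y => innerSL ℝ ((4 : ℝ) • polarForm f y y y) := by
    funext y
    exact (hasGradientAt_polyFun hf y).hasFDerivAt.fderiv
  have h2 : HasFDerivAt (fun y => innerSL ℝ ((4 : ℝ) • polarForm f y y y))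
      ((innerSL ℝ : Euc n →L[ℝ] Euc n →L[ℝ] ℝ) ∘L ((4 : ℝ) • ((3 : ℝ) •
        LinearMap.toContinuousLinearMap (polarForm f x x)))) x :=
    (innerSL ℝ : Euc n →L[ℝ] Euc n →L[ℝ] ℝ).hasFDerivAt.comp x
      ((hasFDerivAt_cube f x).const_smul (4 : ℝ))
  rw [InnerProductSpace.laplacian_eq_iteratedFDeriv_stdOrthonormalBasis]
  simp only [iteratedFDeriv_two_apply, h1, h2.fderiv]
  rw [LinearMap.trace_eq_sum_inner _ (stdOrthonormalBasis ℝ (Euc n)), Finset.mul_sum]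
  refine Finset.sum_congr rfl fun i _ => ?_
  change ⟪(4 : ℝ) • (3 : ℝ) • polarForm f x x (stdOrthonormalBasis ℝ (Euc n) i),
    stdOrthonormalBasis ℝ (Euc n) i⟫ = _
  rw [real_inner_smul_left, real_inner_smul_left, real_inner_comm]
  ring

theorem sphereGrad_polyFun (hf : f.IsHomogeneous 4) (x : Euc n) :
    sphereGrad (polyFun f) x
      = (4 : ℝ) • polarForm f x x x - ⟪x, (4 : ℝ) • polarForm f x x x⟫ • x := by
  rw [sphereGrad, gradient_polyFun hf]

/-- The derivative of the unit normal in directions tangent to the level hypersurface. -/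
theorem fderiv_unitNormal (hf : IsEikonalQuartic f) {x v : Euc n}
    (hx : sphereGrad (polyFun f) x ≠ 0) (hxv : ⟪x, v⟫ = 0) (hgv : ⟪polarForm f x x x, v⟫ = 0) :
    fderiv ℝ (unitNormal (polyFun f)) x v = ‖sphereGrad (polyFun f) x‖⁻¹ •
      ((12 : ℝ) • polarForm f x x v - (4 * ⟪polarForm f x x x, x⟫) • v) := by
  have hG := (isEikonalForm_iff hf.1).2 hf
  set g := sphereGrad (polyFun f) with hg
  have hgx : g x = (4 : ℝ) • polarForm f x x x - ⟪x, (4 : ℝ) • polarForm f x x x⟫ • x :=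
    sphereGrad_polyFun hf.1 x
  have h4 := (hasFDerivAt_cube f x).const_smul (4 : ℝ)
  obtain ⟨g', hg', hg'v⟩ : ∃ g' : Euc n →L[ℝ] Euc n, HasFDerivAt g g' x ∧
      g' v = (12 : ℝ) • polarForm f x x v - (4 * ⟪polarForm f x x x, x⟫) • v := by
    refine ⟨_, HasFDerivAt.congr_of_eventuallyEq
      (h4.fun_sub (((hasFDerivAt_id x).inner ℝ h4).fun_smul (hasFDerivAt_id x)))
      (Filter.Eventually.of_forall fun y => sphereGrad_polyFun hf.1 y), ?_⟩
    have e1 : ⟪x, polarForm f x x v⟫ = 0 := by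
      rw [real_inner_comm, hG.inner_swap, hgv]
    have e2 : ⟪v, polarForm f x x x⟫ = 0 := by rw [real_inner_comm, hgv]
    simp [fderivInnerCLM_apply, real_inner_smul_right, e1, e2, real_inner_comm x]
    module
  have hψ := hg'.inner ℝ hg'
  have hψ0 : ⟪g x, g x⟫ ≠ 0 := inner_self_ne_zero.2 hx
  have hψv : ⟪g x, g' v⟫ = 0 := by
    have e1 : ⟪x, polarForm f x x v⟫ = 0 := by
      rw [real_inner_comm, hG.inner_swap, hgv]
    have e2 := (hG.polarised x v).1
    rw [hg'v, hgx]
    simp only [inner_sub_left, inner_sub_right, real_inner_smul_left, real_inner_smul_right, e1,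
      e2, hgv, hxv]
    ring
  have hr : DifferentiableAt ℝ (fun t : ℝ => (√t)⁻¹) ⟪g x, g x⟫ :=
    (differentiableAt_id.sqrt hψ0).inv (Real.sqrt_ne_zero'.2 (lt_of_le_of_ne
      real_inner_self_nonneg (Ne.symm hψ0)))
  have hφ := hr.hasDerivAt.comp_hasFDerivAt x hψ
  have hN := hφ.fun_smul hg'
  have hfun : unitNormal (polyFun f)
      = fun y => ((fun t : ℝ => (√t)⁻¹) ∘ fun y => ⟪g y, g y⟫) y • g y := by
    funext y
    simp only [unitNormal, Function.comp_apply, ← hg]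
    rw [← norm_eq_sqrt_real_inner]
  rw [hfun, hN.fderiv]
  have hψv' : ⟪g' v, g x⟫ = 0 := by rw [real_inner_comm, hψv]
  simp only [add_apply, smul_apply, ContinuousLinearMap.smulRight_apply,
    ContinuousLinearMap.comp_apply, ContinuousLinearMap.prod_apply, fderivInnerCLM_apply, hψv, hψv',
    Function.comp_apply, add_zero,
    smul_zero, zero_smul]
  rw [← norm_eq_sqrt_real_inner, hg'v]

end Derivatives

/-! ### The Hessian along a normal arc -/

namespace IsEikonalForm

section NormalArc

variable {E : Type*} [NormedAddCommGroup E] [InnerProductSpace ℝ E]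
  {G : E →ₗ[ℝ] E →ₗ[ℝ] E →ₗ[ℝ] E} {e η : E} {C S s σ : ℝ}

variable (h : IsEikonalForm G) (he : IsFocal G e) (hη : η ∈ focalNormal G e) (hη1 : ⟪η, η⟫ = 1)
  (h2 : s ^ 2 - σ ^ 2 = C) (h3 : 2 * s * σ = S) (h4 : s ^ 2 + σ ^ 2 = 1)
include h he hη hη1

/-- On a normal arc `s = cos θ`, `σ = sin θ` the quartic is `cos² 2θ - sin² 2θ = cos 4θ`. -/
theorem quartic_normalArc : ⟪G (s • e + σ • η) (s • e + σ • η) (s • e + σ • η), s • e + σ • η⟫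
    = (s ^ 2 - σ ^ 2) ^ 2 - (2 * s * σ) ^ 2 := by
  have hηe : ⟪η, e⟫ = 0 := by rw [real_inner_comm, h.inner_normal he hη]
  rw [h.quartic_add]
  simp only [map_smul, LinearMap.smul_apply, real_inner_smul_left, real_inner_smul_right,
    he.apply_self, mem_normal.1 hη, (h.isFocal_normal he hη hη1).apply_self, inner_neg_left,
    he.unit, hη1, h.inner_normal he hη, hηe]
  ring

include h2 h3 h4

omit h3 in
theorem hessian_normalArc_normal {z : E} (hz : z ∈ focalNormal G e) (hzη : ⟪η, z⟫ = 0) :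
    G (s • e + σ • η) (s • e + σ • η) z = ((-1 - 2 * C) / 3) • z := by
  have hs : s ^ 2 = (1 + C) / 2 := by linarith
  have hσ : σ ^ 2 = (1 - C) / 2 := by linarith
  simp only [map_add, map_smul, LinearMap.add_apply, LinearMap.smul_apply, mem_normal.1 hz,
    h.swap₁₂ η e, h.apply_normal_normal he hη hz, h.sq_apply_normal he hη hz, hη1, hzη]
  linear_combination (norm := module) (-hs) • z + (1 / 3 * hσ) • z

/-- On the tangent space at `e` the Hessian along a normal arc is a quadratic polynomial in the
shape operator `A`; its values for `A = 0, 1, -1` are `(-1 + 2 C) / 3`, `(1 + 2 S) / 3` and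
`(1 - 2 S) / 3`. -/
theorem hessian_normalArc_tangent {y : E} (hy : y ∈ focalTangent G e) :
    G (s • e + σ • η) (s • e + σ • η) y = ((-1 + 2 * C) / 3) • y
      + (2 / 3 * S) • ((3 / 2 : ℝ) • G e η y)
      + (2 / 3 * (1 - C)) • ((3 / 2 : ℝ) • G e η ((3 / 2 : ℝ) • G e η y)) := by
  have hs : s ^ 2 = (1 + C) / 2 := by linarith
  have hσ : σ ^ 2 = (1 - C) / 2 := by linarith
  simp only [map_add, map_smul, LinearMap.add_apply, LinearMap.smul_apply, mem_tangent.1 hy,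
    h.swap₁₂ η e, h.sq_apply_tangent he hη hy, hη1]
  linear_combination (norm := module) (1 / 3 * hs) • y - hσ • y + h3 • G e η y
    + (3 * hσ) • G e η (G e η y)

/-- An eigenvector of the Hessian orthogonal to a normal arc, split into the eigenvectors found
above. -/
theorem eigenvector_normalArc {v : E} {μ : ℝ} (hve : ⟪e, v⟫ = 0) (hvη : ⟪η, v⟫ = 0)
    (hv : G (s • e + σ • η) (s • e + σ • η) v = μ • v) :
    ∃ y ∈ focalTangent G e, ∃ z ∈ focalNormal G e, v = y + z ∧ ⟪η, z⟫ = 0 ∧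
      ((-1 - 2 * C) / 3 - μ) • z = 0 ∧
      ((-1 + 2 * C) / 3 - μ) • (y - (3 / 2 : ℝ) • G e η ((3 / 2 : ℝ) • G e η y)) = 0 ∧
      ((1 + 2 * S) / 3 - μ) •
        ((3 / 2 : ℝ) • G e η ((3 / 2 : ℝ) • G e η y) + (3 / 2 : ℝ) • G e η y) = 0 ∧
      ((1 - 2 * S) / 3 - μ) •
        ((3 / 2 : ℝ) • G e η ((3 / 2 : ℝ) • G e η y) - (3 / 2 : ℝ) • G e η y) = 0 := by
  obtain ⟨y, hy, z, hz, rfl⟩ := h.exists_tangent_add_normal he hve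
  have hηy : ⟪η, y⟫ = 0 := by rw [real_inner_comm, h.inner_tangent_normal hy hη]
  have hηz : ⟪η, z⟫ = 0 := by rw [inner_add_right, hηy, zero_add] at hvη; exact hvη
  have tang : ∀ w ∈ focalTangent G e, G e η w ∈ focalTangent G e :=
    fun w hw => h.apply_normal_tangent he hη hw
  rw [map_add, h.hessian_normalArc_normal he hη hη1 h2 h4 hz hηz,
    h.hessian_normalArc_tangent he hη hη1 h2 h3 h4 hy] at hv
  -- the tangential and normal parts of the eigenvalue equation
  set w := ((-1 + 2 * C) / 3) • y + (2 / 3 * S) • ((3 / 2 : ℝ) • G e η y)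
      + (2 / 3 * (1 - C)) • ((3 / 2 : ℝ) • G e η ((3 / 2 : ℝ) • G e η y)) - μ • y with hw
  have hwL : w ∈ focalTangent G e := by
    have m1 := Submodule.smul_mem _ (3 / 2 : ℝ) (tang _ hy)
    have m2 := Submodule.smul_mem _ (3 / 2 : ℝ) (tang _ m1)
    exact Submodule.sub_mem _ (Submodule.add_mem _ (Submodule.add_mem _ (Submodule.smul_mem _ _ hy)
      (Submodule.smul_mem _ _ m1)) (Submodule.smul_mem _ _ m2)) (Submodule.smul_mem _ _ hy)
  have hwz : w = -(((-1 - 2 * C) / 3 - μ) • z) := by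
    rw [hw]
    linear_combination (norm := module) hv
  have hw0 : w = 0 := by
    have h5 : ⟪w, ((-1 - 2 * C) / 3 - μ) • z⟫ = 0 :=
      h.inner_tangent_normal hwL (Submodule.smul_mem _ _ hz)
    rw [← inner_self_eq_zero (𝕜 := ℝ)]
    conv_lhs => arg 3; rw [hwz]
    rw [inner_neg_right, h5, neg_zero]
  have hc := h.shape_cube he hη hη1 hy
  have k0 := hw0
  rw [hw] at k0
  have k1 := congrArg (G e η) k0
  have k2 := congrArg (G e η) k1
  simp only [map_add, map_sub, map_smul, map_zero] at k0 k1 k2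
  have hc' := congrArg (G e η) hc
  simp only [map_smul] at hc'
  refine ⟨y, hy, z, hz, rfl, hηz, ?_, ?_, ?_, ?_⟩
  · rw [hwz, neg_eq_zero] at hw0; exact hw0
  · simp only [map_smul]
    linear_combination (norm := module) k0 - (9 / 4 : ℝ) • k2
      + (1 / 4 * S) • hc + (3 / 8 * (1 - C)) • hc'
  · simp only [map_smul]
    linear_combination (norm := module) (9 / 4 : ℝ) • k2 + (3 / 2 : ℝ) • k1
      - (1 / 4 * S) • hc - (3 / 8 * (1 - C)) • hc' - (1 / 4 * (1 - C)) • hc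
  · simp only [map_smul]
    linear_combination (norm := module) (9 / 4 : ℝ) • k2 - (3 / 2 : ℝ) • k1
      - (1 / 4 * S) • hc - (3 / 8 * (1 - C)) • hc' + (1 / 4 * (1 - C)) • hc

end NormalArc

end IsEikonalForm

/-! ### Principal curvatures -/

section Curvature

variable {n : ℕ} {f : MvPolynomial (Fin n) ℝ} {e η x : Euc n} {C S s σ : ℝ}

theorem sphereGrad_normalArc (hf : IsEikonalQuartic f)
    (hc : ⟪polarForm f x x x, x⟫ = C ^ 2 - S ^ 2)
    (hg : polarForm f x x x = (C ^ 2 - S ^ 2) • x + (2 * S * C) • (σ • e - s • η)) :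
    sphereGrad (polyFun f) x = (4 * (2 * S * C)) • (σ • e - s • η) := by
  rw [sphereGrad_polyFun hf.1, real_inner_smul_right, real_inner_comm, hc, hg]
  module

theorem unitNormal_normalArc (hf : IsEikonalQuartic f) (hC : 0 < C) (hS : 0 < S)
    (hN : ‖σ • e - s • η‖ = 1)
    (hc : ⟪polarForm f x x x, x⟫ = C ^ 2 - S ^ 2)
    (hg : polarForm f x x x = (C ^ 2 - S ^ 2) • x + (2 * S * C) • (σ • e - s • η)) :
    unitNormal (polyFun f) x = σ • e - s • η := by
  have hd : 0 < 4 * (2 * S * C) := by positivity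
  rw [unitNormal, sphereGrad_normalArc hf hc hg, norm_smul, hN, mul_one, Real.norm_of_nonneg hd.le,
    inv_smul_smul₀ hd.ne']

variable (hf : IsEikonalQuartic f) (he : IsFocal (polarForm f) e)
  (hη : η ∈ focalNormal (polarForm f) e) (hη1 : ⟪η, η⟫ = 1) (hC : 0 < C) (hS : 0 < S)
  (h1 : C ^ 2 + S ^ 2 = 1) (h2 : s ^ 2 - σ ^ 2 = C) (h3 : 2 * s * σ = S) (h4 : s ^ 2 + σ ^ 2 = 1)
  (hx : x = s • e + σ • η)
  (hg : polarForm f x x x = (C ^ 2 - S ^ 2) • x + (2 * S * C) • (σ • e - s • η))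
include hf he hη hη1 hC hS h2 h3 h4 hx hg

/-- The principal directions at a point of a normal arc are the eigenvectors of the Hessian
orthogonal to the arc: with `cos 4θ = C² - S²` and `sin 4θ = 2 S C`, the derivative of the unit
normal `N` in such a direction `v` is `D_v N = (3 G x x v - (C² - S²) v) / (2 S C)`. -/
theorem mem_principalSpace (μ : ℝ) (v : Euc n) :
    v ∈ principalSpace (polyFun f) x ((C ^ 2 - S ^ 2 - 3 * μ) / (2 * S * C)) ↔
      ⟪e, v⟫ = 0 ∧ ⟪η, v⟫ = 0 ∧ polarForm f x x v = μ • v := by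
  have h := (isEikonalForm_iff hf.1).2 hf
  have heη := h.inner_normal he hη
  have hηe : ⟪η, e⟫ = 0 := by rw [real_inner_comm, heη]
  have hd : 0 < 2 * S * C := by positivity
  have hx1 : ⟪x, x⟫ = 1 := by
    rw [hx]
    simp only [inner_add_left, inner_add_right, real_inner_smul_left, real_inner_smul_right,
      he.unit, hη1, heη, hηe]
    linear_combination h4
  have hc : ⟪polarForm f x x x, x⟫ = C ^ 2 - S ^ 2 := by
    rw [hx, h.quartic_normalArc he hη hη1, h2, h3]
  have hN : ‖σ • e - s • η‖ = 1 := by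
    have : ⟪σ • e - s • η, σ • e - s • η⟫ = 1 := by
      simp only [inner_sub_left, inner_sub_right, real_inner_smul_left, real_inner_smul_right,
        he.unit, hη1, heη, hηe]
      linear_combination h4
    rw [real_inner_self_eq_norm_sq] at this
    nlinarith [norm_nonneg (σ • e - s • η)]
  have hsg := sphereGrad_normalArc hf hc hg
  have hsgn : ‖sphereGrad (polyFun f) x‖ = 4 * (2 * S * C) := by
    rw [hsg, norm_smul, hN, mul_one, Real.norm_of_nonneg (by positivity)]
  have hsg0 : sphereGrad (polyFun f) x ≠ 0 := by
    rw [← norm_ne_zero_iff, hsgn]; positivity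
  have htan : v ∈ levelTangent (polyFun f) x ↔ ⟪e, v⟫ = 0 ∧ ⟪η, v⟫ = 0 := by
    rw [levelTangent, unitNormal_normalArc hf hC hS hN hc hg, Submodule.mem_orthogonal]
    have he' : e = s • x + σ • (σ • e - s • η) := by
      rw [hx]; linear_combination (norm := module) -h4 • e
    have hη' : η = σ • x - s • (σ • e - s • η) := by
      rw [hx]; linear_combination (norm := module) -h4 • η
    constructor
    · intro hv
      have v1 := hv x (Submodule.subset_span (by simp))
      have v2 := hv (σ • e - s • η) (Submodule.subset_span (by simp))
      constructor
      · rw [he', inner_add_left, real_inner_smul_left, real_inner_smul_left, v1, v2]; ring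
      · rw [hη', inner_sub_left, real_inner_smul_left, real_inner_smul_left, v1, v2]; ring
    · rintro ⟨v1, v2⟩ u hu
      obtain ⟨a, b, rfl⟩ := Submodule.mem_span_pair.1 hu
      rw [hx]
      simp only [inner_add_left, inner_sub_left, real_inner_smul_left, v1, v2]
      ring
  rw [principalSpace, Submodule.mem_inf, htan, Module.End.mem_eigenspace_iff, and_assoc]
  refine and_congr_right fun v1 => and_congr_right fun v2 => ?_
  have hxv : ⟪x, v⟫ = 0 := by
    rw [hx, inner_add_left, real_inner_smul_left, real_inner_smul_left, v1, v2]; ring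
  have hgv : ⟪polarForm f x x x, v⟫ = 0 := by
    rw [hg]
    simp only [inner_add_left, inner_sub_left, real_inner_smul_left, hxv, v1, v2]
    ring
  have hD := fderiv_unitNormal hf hsg0 hxv hgv
  rw [hsgn, hc] at hD
  rw [LinearMap.neg_apply, ContinuousLinearMap.coe_coe, hD]
  set d := 2 * S * C
  constructor
  · intro hk
    have hk' := congrArg (fun w => (d / 3) • w) hk
    simp only [smul_neg, smul_smul] at hk'
    have a1 : d / 3 * (4 * d)⁻¹ = 1 / 12 := by field_simp; norm_num
    have a2 : d / 3 * ((C ^ 2 - S ^ 2 - 3 * μ) / d) = (C ^ 2 - S ^ 2 - 3 * μ) / 3 := by field_simp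
    rw [a1, a2] at hk'
    linear_combination (norm := module) -hk'
  · intro hk
    rw [hk]
    have a3 : (C ^ 2 - S ^ 2 - 3 * μ) / d = (4 * d)⁻¹ * (4 * (C ^ 2 - S ^ 2) - 12 * μ) := by
      field_simp
      ring
    rw [a3]
    module

include h1

/-- The four principal spaces at a point of a normal arc from `e` to `η`, in the order of decreasing
curvature. The eigenvalues of the Hessian are separated because `0 < C, S < 1 < C + S`. -/
theorem principalSpace_eq :
    principalSpace (polyFun f) x ((C ^ 2 - S ^ 2 - 3 * ((-1 - 2 * C) / 3)) / (2 * S * C))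
      = focalNormal (polarForm f) e ⊓ (ℝ ∙ η)ᗮ ∧
    principalSpace (polyFun f) x ((C ^ 2 - S ^ 2 - 3 * ((1 - 2 * S) / 3)) / (2 * S * C))
      = shapeSpace (polarForm f) e η (-1) ∧
    principalSpace (polyFun f) x ((C ^ 2 - S ^ 2 - 3 * ((-1 + 2 * C) / 3)) / (2 * S * C))
      = shapeSpace (polarForm f) e η 0 ∧
    principalSpace (polyFun f) x ((C ^ 2 - S ^ 2 - 3 * ((1 + 2 * S) / 3)) / (2 * S * C))
      = shapeSpace (polarForm f) e η 1 := by
  have h := (isEikonalForm_iff hf.1).2 hf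
  have hmem := mem_principalSpace hf he hη hη1 hC hS h2 h3 h4 hx hg
  have hC1 : C < 1 := by nlinarith
  have hS1 : S < 1 := by nlinarith
  have hCS : 1 < C + S := by nlinarith
  have res : ∀ {r : ℝ} {w : Euc n}, r • w = 0 → r ≠ 0 → w = 0 :=
    fun hrw hr => (smul_eq_zero.1 hrw).resolve_left hr
  have hηy : ∀ y ∈ focalTangent (polarForm f) e, ⟪η, y⟫ = 0 := fun y hy => by
    rw [real_inner_comm, h.inner_tangent_normal hy hη]
  refine ⟨?_, ?_, ?_, ?_⟩
  · ext v
    rw [hmem, Submodule.mem_inf, Submodule.mem_orthogonal_singleton_iff_inner_right]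
    constructor
    · rintro ⟨v1, v2, hv⟩
      rw [hx] at hv
      obtain ⟨y, hy, z, hz, rfl, hηz, -, a2, a3, a1⟩ :=
        h.eigenvector_normalArc he hη hη1 h2 h3 h4 v1 v2 hv
      have b2 := res a2 (by linarith)
      have b3 := res a3 (by linarith)
      have b1 := res a1 (by linarith)
      have hy0 : y = 0 := by
        linear_combination (norm := module) b2 + (1 / 2 : ℝ) • b3 + (1 / 2 : ℝ) • b1
      rw [hy0, zero_add]
      exact ⟨hz, hηz⟩
    · rintro ⟨hv, hv2⟩
      refine ⟨h.inner_normal he hv, hv2, ?_⟩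
      rw [hx, h.hessian_normalArc_normal he hη hη1 h2 h4 hv hv2]
  · ext v
    rw [hmem, IsEikonalForm.mem_shapeSpace]
    constructor
    · rintro ⟨v1, v2, hv⟩
      rw [hx] at hv
      obtain ⟨y, hy, z, hz, rfl, hηz, a0, a2, a3, a1⟩ :=
        h.eigenvector_normalArc he hη hη1 h2 h3 h4 v1 v2 hv
      have b0 := res a0 (by linarith)
      have b2 := res a2 (by linarith)
      have b3 := res a3 (by linarith)
      rw [b0, add_zero]
      refine ⟨hy, ?_⟩
      linear_combination (norm := module) b2 + b3
    · rintro ⟨hv, hv2⟩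
      refine ⟨h.inner_tangent he hv, hηy v hv, ?_⟩
      rw [hx, h.hessian_normalArc_tangent he hη hη1 h2 h3 h4 hv, hv2, map_smul]
      linear_combination (norm := module) (-(2 / 3 * (1 - C))) • hv2
  · ext v
    rw [hmem, IsEikonalForm.mem_shapeSpace]
    constructor
    · rintro ⟨v1, v2, hv⟩
      rw [hx] at hv
      obtain ⟨y, hy, z, hz, rfl, hηz, a0, a2, a3, a1⟩ :=
        h.eigenvector_normalArc he hη hη1 h2 h3 h4 v1 v2 hv
      have b0 := res a0 (by linarith)
      have b3 := res a3 (by linarith)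
      have b1 := res a1 (by linarith)
      rw [b0, add_zero]
      refine ⟨hy, ?_⟩
      linear_combination (norm := module) (1 / 2 : ℝ) • b3 - (1 / 2 : ℝ) • b1
    · rintro ⟨hv, hv2⟩
      refine ⟨h.inner_tangent he hv, hηy v hv, ?_⟩
      rw [hx, h.hessian_normalArc_tangent he hη hη1 h2 h3 h4 hv, hv2, zero_smul, map_zero]
      module
  · ext v
    rw [hmem, IsEikonalForm.mem_shapeSpace]
    constructor
    · rintro ⟨v1, v2, hv⟩
      rw [hx] at hv
      obtain ⟨y, hy, z, hz, rfl, hηz, a0, a2, a3, a1⟩ :=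
        h.eigenvector_normalArc he hη hη1 h2 h3 h4 v1 v2 hv
      have b0 := res a0 (by linarith)
      have b2 := res a2 (by linarith)
      have b1 := res a1 (by linarith)
      rw [b0, add_zero]
      refine ⟨hy, ?_⟩
      linear_combination (norm := module) -b2 - b1
    · rintro ⟨hv, hv2⟩
      refine ⟨h.inner_tangent he hv, hηy v hv, ?_⟩
      rw [hx, h.hessian_normalArc_tangent he hη hη1 h2 h3 h4 hv, hv2, one_smul, hv2]
      module

end Curvature

/-- A regular eikonal quartic with a maximum point is isoparametric. -/
theorem polarForm_regular_isoparametric {n : ℕ} {f : MvPolynomial (Fin n) ℝ}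
    (hf : IsEikonalQuartic f) (hr : IsRegularForm (polarForm f))
    (hne : ∃ e, IsFocal (polarForm f) e) : ∃ q ν : ℕ, 2 ≤ q ∧ 1 ≤ ν ∧
      IsIsoparametricWith f (q - 1) ν ∧
      ∀ e, IsFocal (polarForm f) e → Module.finrank ℝ (focalNormal (polarForm f) e) = q ∧
        Module.finrank ℝ (focalTangent (polarForm f) e) = q - 1 + 2 * ν ∧
        ∀ η ∈ focalNormal (polarForm f) e, ⟪η, η⟫ = 1 →
          Module.finrank ℝ (shapeSpace (polarForm f) e η 1) = ν ∧
          Module.finrank ℝ (shapeSpace (polarForm f) e η (-1)) = ν ∧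
          Module.finrank ℝ (shapeSpace (polarForm f) e η 0) = q - 1 := by
  obtain ⟨q, ν, hq, hν, hn, hlap, hmult⟩ := hr.multiplicities hne
  rw [finrank_euclideanSpace_fin] at hn
  have hunit : ∀ {c : ℝ} {x : Euc n}, x ∈ sphereLevel (polyFun f) c →
      ⟪x, x⟫ = 1 ∧ ⟪polarForm f x x x, x⟫ = c := by
    rintro c x ⟨hx1, hx2⟩
    exact ⟨by rw [real_inner_self_eq_norm_sq, hx1, one_pow], by rw [← polyFun_eq hf.1, hx2]⟩
  refine ⟨q, ν, hq, hν, ⟨hf, ?_, by omega, by omega, by omega, ?_, ?_, ?_⟩, fun e he =>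
    ⟨(hmult e he).1, (hmult e he).2.1, fun η hη hη1 => ?_⟩⟩
  · intro x
    rw [laplacian_polyFun hf.1, hlap, real_inner_self_eq_norm_sq]
    ring
  · intro c hc
    obtain ⟨C, S, s, σ, hC, hS, hcc, hCS, hs1, hs2, hs3⟩ := exists_angle hc
    obtain ⟨e, he⟩ := hne
    obtain ⟨z, hz, _, _, hz0⟩ := hr.shape e he
    have hz1 : z ≠ 0 := by
      rintro rfl
      simp at hz0
    have hzn : ‖z‖ ≠ 0 := norm_ne_zero_iff.2 hz1
    set η := ‖z‖⁻¹ • z with hηdef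
    have hη : η ∈ focalNormal (polarForm f) e := Submodule.smul_mem _ _ hz
    have hη1 : ⟪η, η⟫ = 1 := by
      rw [hηdef, real_inner_smul_left, real_inner_smul_right, real_inner_self_eq_norm_sq]
      field_simp
    have heη := hr.inner_normal he hη
    have hηe : ⟪η, e⟫ = 0 := by rw [real_inner_comm, heη]
    refine ⟨s • e + σ • η, ?_, ?_⟩
    · have : ⟪s • e + σ • η, s • e + σ • η⟫ = 1 := by
        simp only [inner_add_left, inner_add_right, real_inner_smul_left, real_inner_smul_right,
          he.unit, hη1, heη, hηe]
        linear_combination hs3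
      rw [real_inner_self_eq_norm_sq] at this
      nlinarith [norm_nonneg (s • e + σ • η)]
    · rw [polyFun_eq hf.1, hr.quartic_normalArc he hη hη1, hs1, hs2, hcc]
  · intro c hc x hx h0
    obtain ⟨hx1, hxc⟩ := hunit hx
    rw [sphereGrad_polyFun hf.1, real_inner_smul_right, real_inner_comm, hxc, sub_eq_zero] at h0
    have h1 : polarForm f x x x = c • x := by
      linear_combination (norm := module) (1 / 4 : ℝ) • h0
    have h2 := hr.eikonal x
    rw [h1, real_inner_smul_left, real_inner_smul_right, hx1] at h2
    obtain ⟨hc1, hc2⟩ := hc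
    nlinarith
  · intro c hc
    obtain ⟨C, S, s, σ, hC, hS, hcc, hCS, hs1, hs2, hs3⟩ := exists_angle hc
    have hC1 : C < 1 := by nlinarith
    have hS1 : S < 1 := by nlinarith
    have hCS1 : 1 < C + S := by nlinarith
    have hd : 0 < 2 * S * C := by positivity
    refine ⟨![(C ^ 2 - S ^ 2 - 3 * ((-1 - 2 * C) / 3)) / (2 * S * C),
      (C ^ 2 - S ^ 2 - 3 * ((1 - 2 * S) / 3)) / (2 * S * C),
      (C ^ 2 - S ^ 2 - 3 * ((-1 + 2 * C) / 3)) / (2 * S * C),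
      (C ^ 2 - S ^ 2 - 3 * ((1 + 2 * S) / 3)) / (2 * S * C)], ?_, fun x hx i => ?_⟩
    · rw [Fin.strictAnti_iff_succ_lt]
      intro i
      fin_cases i <;> simp <;> refine (div_lt_div_iff_of_pos_right hd).2 ?_ <;> linarith
    · obtain ⟨hx1, hxc⟩ := hunit hx
      obtain ⟨e, η, he, hη, hη1, hxe, hg⟩ :=
        hr.exists_focal hx1 (hxc.trans hcc.symm) hC hS hCS hs1 hs2 hs3
      obtain ⟨p0, p1, p2, p3⟩ := principalSpace_eq hf he hη hη1 hC hS hCS hs1 hs2 hs3 hxe hg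
      obtain ⟨m3, m1, m2, m0⟩ := (hmult e he).2.2 η hη hη1
      rw [← p0] at m0
      rw [← p1] at m1
      rw [← p2] at m2
      rw [← p3] at m3
      fin_cases i
      · exact m0.trans (by simp)
      · have : ¬ Even 1 := by decide
        exact m1.trans (by simp [this])
      · exact m2.trans (by simp)
      · have : ¬ Even 3 := by decide
        exact m3.trans (by simp [this])
  · obtain ⟨m3, m1, m2, -⟩ := (hmult e he).2.2 η hη hη1
    exact ⟨m3, m1, m2⟩

/-! ### The normal form at a maximum point -/

section NormalForm

variable {n : ℕ} {f : MvPolynomial (Fin n) ℝ} {e : Euc n}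

/-- The shape operators of the focal variety at `e`, as endomorphisms of the tangent space. -/
noncomputable def tangentShape {G : Euc n →ₗ[ℝ] Euc n →ₗ[ℝ] Euc n →ₗ[ℝ] Euc n}
    (h : IsEikonalForm G) (he : IsFocal G e) :
    focalNormal G e →ₗ[ℝ] focalTangent G e →ₗ[ℝ] focalTangent G e :=
  LinearMap.mk₂ ℝ (fun η ξ => ⟨(3 / 2 : ℝ) • G e η ξ,
      Submodule.smul_mem _ _ (h.apply_normal_tangent he η.2 ξ.2)⟩)
    (fun _ _ _ => Subtype.ext (by simp)) (fun c _ _ => Subtype.ext (by simp [smul_comm c]))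
    (fun _ _ _ => Subtype.ext (by simp)) (fun c _ _ => Subtype.ext (by simp [smul_comm c]))

theorem coe_tangentShape {G : Euc n →ₗ[ℝ] Euc n →ₗ[ℝ] Euc n →ₗ[ℝ] Euc n}
    (h : IsEikonalForm G) (he : IsFocal G e) (η : focalNormal G e) (ξ : focalTangent G e) :
    (tangentShape h he η ξ : Euc n) = (3 / 2 : ℝ) • G e η ξ := rfl

/-- The eigenspaces in a normal direction `η` of arbitrary length are those in the unit
direction. -/
theorem finrank_eigenspace_tangentShape {G : Euc n →ₗ[ℝ] Euc n →ₗ[ℝ] Euc n →ₗ[ℝ] Euc n}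
    (h : IsEikonalForm G) (he : IsFocal G e) {η : focalNormal G e} (hη : η ≠ 0) (c : ℝ) :
    Module.finrank ℝ (Module.End.eigenspace (tangentShape h he η) (c * ‖η‖))
      = Module.finrank ℝ (shapeSpace G e (‖η‖⁻¹ • (η : Euc n)) c) := by
  have hn : ‖η‖ ≠ 0 := norm_ne_zero_iff.2 hη
  have hmap : (Module.End.eigenspace (tangentShape h he η) (c * ‖η‖)).map
      (focalTangent G e).subtype = shapeSpace G e (‖η‖⁻¹ • (η : Euc n)) c := by
    ext v
    rw [Submodule.mem_map, IsEikonalForm.mem_shapeSpace]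
    constructor
    · rintro ⟨ξ, hξ, rfl⟩
      rw [Module.End.mem_eigenspace_iff] at hξ
      have hξ' := congrArg Subtype.val hξ
      rw [coe_tangentShape, Submodule.coe_smul] at hξ'
      refine ⟨ξ.2, ?_⟩
      rw [Submodule.subtype_apply, map_smul, LinearMap.smul_apply, smul_comm, hξ', smul_smul]
      congr 1
      field_simp
    · rintro ⟨hv, hv2⟩
      refine ⟨⟨v, hv⟩, ?_, rfl⟩
      rw [Module.End.mem_eigenspace_iff]
      apply Subtype.ext
      rw [coe_tangentShape, Submodule.coe_smul]
      rw [map_smul, LinearMap.smul_apply, smul_comm] at hv2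
      have := congrArg (fun w => ‖η‖ • w) hv2
      simp only [smul_smul] at this
      rw [mul_inv_cancel_left₀ hn] at this
      rw [mul_comm c]
      exact this
  rw [← hmap, Submodule.finrank_map_subtype_eq]

/-- The normal form is the expansion of the quartic at `s e + (ξ + η)` in powers of `s`. -/
theorem hasNormalForm (hf : IsEikonalQuartic f) (he : IsFocal (polarForm f) e) {q ν : ℕ}
    (hM : Module.finrank ℝ (focalNormal (polarForm f) e) = q)
    (hL : Module.finrank ℝ (focalTangent (polarForm f) e) = q - 1 + 2 * ν)
    (hA : ∀ η ∈ focalNormal (polarForm f) e, ⟪η, η⟫ = 1 →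
      Module.finrank ℝ (shapeSpace (polarForm f) e η 1) = ν ∧
      Module.finrank ℝ (shapeSpace (polarForm f) e η (-1)) = ν ∧
      Module.finrank ℝ (shapeSpace (polarForm f) e η 0) = q - 1) :
    HasNormalForm f e (q - 1 + 2 * ν) q ν := by
  have h := (isEikonalForm_iff hf.1).2 hf
  refine ⟨focalTangent (polarForm f) e, focalNormal (polarForm f) e, tangentShape h he, ?_, ?_,
    hL, hM, ?_, ?_, ?_⟩
  · exact Submodule.isOrtho_iff_inner_eq.2 fun x hx y hy => h.inner_tangent_normal hx hy
  · ext v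
    rw [Submodule.mem_sup, Submodule.mem_orthogonal_singleton_iff_inner_right]
    constructor
    · rintro ⟨y, hy, z, hz, rfl⟩
      rw [inner_add_right, h.inner_tangent he hy, h.inner_normal he hz, add_zero]
    · intro hv
      obtain ⟨y, hy, z, hz, rfl⟩ := h.exists_tangent_add_normal he hv
      exact ⟨y, hy, z, hz, rfl⟩
  · intro η x y
    rw [Submodule.coe_inner, Submodule.coe_inner, coe_tangentShape, coe_tangentShape,
      real_inner_smul_left, real_inner_smul_right, h.inner_swap, real_inner_comm]
  · rintro s ⟨y, hy⟩ ⟨z, hz⟩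
    rw [Submodule.coe_inner, coe_tangentShape, Submodule.coe_norm, Submodule.coe_norm]
    simp only
    have hey : ⟪e, y + z⟫ = 0 := by
      rw [inner_add_right, h.inner_tangent he hy, h.inner_normal he hz, add_zero]
    have hyz := h.inner_tangent_normal hy hz
    have hzy : ⟪z, y⟫ = 0 := by rw [real_inner_comm, hyz]
    have e1 : ⟪polarForm f (y + z) (y + z) (y + z), e⟫ = 3 * ⟪polarForm f e z y, y⟫ := by
      rw [h.inner_swap₁]
      have e3 : ⟪polarForm f e y y, z⟫ = ⟪polarForm f e z y, y⟫ := by rw [h.inner_swap, h.swap₂₃]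
      simp only [map_add, LinearMap.add_apply, inner_add_left, inner_add_right, e3,
        h.cubic_tangent he hy hy hy, h.apply_normal_normal he hz hz,
        real_inner_smul_left, h.inner_tangent he hy, h.inner_normal he hz, h.swap₂₃ e y z]
      have e4 : ⟪polarForm f e z y, z⟫ = 0 := h.inner_tangent_normal
        (h.apply_normal_tangent he hz hy) hz
      rw [e4]
      ring
    have e5 : ⟪polarForm f e e (y + z), y + z⟫ = 1 / 3 * ⟪y, y⟫ - ⟪z, z⟫ := by
      simp only [map_add, IsEikonalForm.mem_tangent.1 hy, IsEikonalForm.mem_normal.1 hz,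
        inner_add_left, inner_add_right, real_inner_smul_left, inner_neg_left, hyz, hzy]
      ring
    rw [add_assoc, polyFun_eq hf.1, h.quartic_add, polyFun_eq hf.1]
    simp only [map_smul, LinearMap.smul_apply, he.apply_self, real_inner_smul_left,
      real_inner_smul_right, he.unit, hey, e1, e5, ← real_inner_self_eq_norm_sq]
    ring
  · intro η hη
    have hn : ‖η‖ ≠ 0 := norm_ne_zero_iff.2 hη
    obtain ⟨m1, m2, m3⟩ := hA (‖η‖⁻¹ • (η : Euc n)) (Submodule.smul_mem _ _ η.2) (by
      rw [real_inner_smul_left, real_inner_smul_right, real_inner_self_eq_norm_sq,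
        ← Submodule.coe_norm]
      field_simp)
    have k1 := finrank_eigenspace_tangentShape h he hη 1
    have k2 := finrank_eigenspace_tangentShape h he hη (-1)
    have k3 := finrank_eigenspace_tangentShape h he hη 0
    rw [one_mul] at k1
    rw [neg_one_mul] at k2
    rw [zero_mul] at k3
    exact ⟨k1.trans m1, k2.trans m2, by rw [k3, m3]⟩

end NormalForm

/-! ### Primitive quartics -/

section Primitive

variable {n : ℕ} {f : MvPolynomial (Fin n) ℝ}

theorem isPrimitive_of_eq (H : Submodule ℝ (Euc n))
    (h : (∀ x, polyFun f x = primitiveForm H x) ∨ ∀ x, polyFun f x = -primitiveForm H x) :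
    IsPrimitiveQuartic f :=
  ⟨H, LinearIsometryEquiv.refl ℝ _, by simpa using h⟩

/-- Without points where the quartic is `1`, every point of the unit sphere would have the value
`-1`, by `exists_focal`, and the quartic would be `-|x|⁴`, which is primitive. -/
theorem exists_isFocal_of_not_primitive (hf : IsEikonalQuartic f) (hp : ¬ IsPrimitiveQuartic f) :
    ∃ e, IsFocal (polarForm f) e := by
  have h := (isEikonalForm_iff hf.1).2 hf
  by_contra hne
  push Not at hne
  have hunit : ∀ x : Euc n, ⟪x, x⟫ = 1 → ⟪polarForm f x x x, x⟫ = -1 := by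
    intro x hx
    have hle := h.quartic_le hx
    by_contra h2
    by_cases h1 : ⟪polarForm f x x x, x⟫ = 1
    · refine hne x ⟨hx, ?_⟩
      rw [h.apply_eq_of_quartic (by rw [h1, hx, one_pow]), hx, one_smul]
    · obtain ⟨C, S, s, σ, hC, hS, hc, hCS, hs1, hs2, hs3⟩ := exists_angle
        (c := ⟪polarForm f x x x, x⟫) ⟨lt_of_le_of_ne (by nlinarith) (Ne.symm h2),
          lt_of_le_of_ne (by nlinarith) h1⟩
      obtain ⟨e, -, he, -⟩ := h.exists_focal hx hc.symm hC hS hCS hs1 hs2 hs3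
      exact hne e he
  refine hp (isPrimitive_of_eq ⊥ (Or.inr fun x => ?_))
  have hpf := primitiveForm_eq (n := n) (H := ⊥) (u := 0) (v := x) (Submodule.zero_mem _) (by simp)
  rw [zero_add] at hpf
  rw [hpf, polyFun_eq hf.1, inner_zero_left]
  rcases eq_or_ne x 0 with rfl | hx
  · simp
  have hxn : ‖x‖ ≠ 0 := norm_ne_zero_iff.2 hx
  have := hunit (‖x‖⁻¹ • x) (by
    rw [real_inner_smul_left, real_inner_smul_right, real_inner_self_eq_norm_sq]
    field_simp)
  simp only [map_smul, LinearMap.smul_apply, real_inner_smul_left, real_inner_smul_right] at this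
  rw [real_inner_self_eq_norm_sq]
  field_simp at this
  linarith

theorem isRegularForm_of_not_primitive (hf : IsEikonalQuartic f) (hp : ¬ IsPrimitiveQuartic f) :
    IsRegularForm (polarForm f) := by
  have h := (isEikonalForm_iff hf.1).2 hf
  have h1 : ∀ e, IsFocal (polarForm f) e → _ := fun e he =>
    (h.codim_and_shape_or_primitive he).resolve_right fun ⟨H, hH⟩ => hp (isPrimitive_of_eq H
      (hH.imp (fun k x => by rw [polyFun_eq hf.1, k]) fun k x => by rw [polyFun_eq hf.1, k]))
  have h2 : ∀ e, IsFocal (-polarForm f) e → _ := fun e he =>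
    (h.neg.codim_and_shape_or_primitive he).resolve_right fun ⟨H, hH⟩ => hp (isPrimitive_of_eq H
      (hH.symm.imp
        (fun k x => by
          have := k x
          simp only [LinearMap.neg_apply, inner_neg_left, neg_inj] at this
          rw [polyFun_eq hf.1, this])
        fun k x => by
          have := k x
          simp only [LinearMap.neg_apply, inner_neg_left] at this
          rw [polyFun_eq hf.1, ← this, neg_neg]))
  exact ⟨h, fun e he => (h1 e he).1, fun e he => (h2 e he).1, fun e he => (h1 e he).2⟩

/-- If the value `1` is attained on the unit sphere, the maximum points are the focal points. -/
theorem isFocal_of_isMax (hf : IsEikonalQuartic f) (hne : ∃ e, IsFocal (polarForm f) e) {e : Euc n}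
    (he : ‖e‖ = 1) (hmax : ∀ y : Euc n, ‖y‖ = 1 → polyFun f y ≤ polyFun f e) :
    IsFocal (polarForm f) e := by
  have h := (isEikonalForm_iff hf.1).2 hf
  obtain ⟨a, ha⟩ := hne
  have he1 : ⟪e, e⟫ = 1 := by rw [real_inner_self_eq_norm_sq, he, one_pow]
  have ha1 : ‖a‖ = 1 := by
    have := ha.unit
    rw [real_inner_self_eq_norm_sq] at this
    nlinarith [norm_nonneg a]
  have hle := hmax a ha1
  rw [polyFun_eq hf.1, polyFun_eq hf.1, ha.apply_self, ha.unit] at hle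
  have hle2 := h.quartic_le he1
  have hq : ⟪polarForm f e e e, e⟫ = 1 := by nlinarith
  refine ⟨he1, ?_⟩
  rw [h.apply_eq_of_quartic (by rw [hq, he1, one_pow]), he1, one_smul]

/-- In an orthonormal basis adapted to `H` the form `h_{4,H}` is standard. -/
theorem exists_isometry_primitiveForm (H : Submodule ℝ (Euc n)) :
    ∃ V : Euc n ≃ₗᵢ[ℝ] Euc n, ∀ x,
      primitiveForm H (V x) = standardQuartic n (Module.finrank ℝ H) x := by
  set k := Module.finrank ℝ H with hk
  have hkn : k ≤ n := by
    have := H.finrank_le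
    rwa [finrank_euclideanSpace_fin] at this
  let v : Fin n → Euc n := fun i =>
    if hi : i.val < k then (stdOrthonormalBasis ℝ H ⟨i.val, hi⟩ : Euc n) else 0
  have hv : Orthonormal ℝ (Set.domRestrict {i : Fin n | i.val < k} v) := by
    have h1 : Orthonormal ℝ fun j : Fin k => (stdOrthonormalBasis ℝ H j : Euc n) :=
      (stdOrthonormalBasis ℝ H).orthonormal.comp_linearIsometry H.subtypeₗᵢ
    have h2 : Set.domRestrict {i : Fin n | i.val < k} v
        = (fun j : Fin k => (stdOrthonormalBasis ℝ H j : Euc n)) ∘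
          fun i : {i : Fin n | i.val < k} => (⟨i.1.val, i.2⟩ : Fin k) := by
      funext i
      have hi : i.1.val < k := i.2
      change v i.1 = _
      simp only [v, Function.comp_apply, dif_pos hi]
    rw [h2]
    refine h1.comp _ fun i j hij => ?_
    simp only [Fin.mk.injEq] at hij
    exact Subtype.ext (Fin.ext hij)
  obtain ⟨b, hb⟩ := hv.exists_orthonormalBasis_extension_of_card_eq (by simp)
  have hbH : ∀ i : Fin n, i.val < k → b i ∈ H := by
    intro i hi
    rw [hb i hi]
    simp only [v, dif_pos hi]
    exact Submodule.coe_mem _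
  have hbO : ∀ i : Fin n, k ≤ i.val → b i ∈ Hᗮ := by
    intro i hi
    have key : ∀ j : Fin k, ⟪(stdOrthonormalBasis ℝ H j : Euc n), b i⟫ = 0 := by
      intro j
      have hj : (⟨j.val, j.2.trans_le hkn⟩ : Fin n).val < k := j.2
      have h1 : b ⟨j.val, j.2.trans_le hkn⟩ = stdOrthonormalBasis ℝ H j := by
        rw [hb _ hj]
        simp only [v, dif_pos hj]
        rfl
      rw [← h1]
      refine b.orthonormal.2 fun h2 => ?_
      rw [← h2] at hi
      exact absurd hj (not_lt.2 hi)
    rw [Submodule.mem_orthogonal]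
    intro u hu
    have hu' := congrArg Subtype.val ((stdOrthonormalBasis ℝ H).sum_repr ⟨u, hu⟩)
    simp only [Submodule.coe_sum, Submodule.coe_smul] at hu'
    rw [← hu', sum_inner]
    exact Finset.sum_eq_zero fun j _ => by rw [real_inner_smul_left, key, mul_zero]
  have hnorm : ∀ (s : Finset (Fin n)) (x : Euc n),
      ⟪∑ i ∈ s, x i • b i, ∑ i ∈ s, x i • b i⟫ = ∑ i ∈ s, x i ^ 2 := by
    intro s x
    rw [b.orthonormal.inner_sum]
    exact Finset.sum_congr rfl fun i _ => by simp [sq]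
  refine ⟨b.repr.symm, fun x => ?_⟩
  have hsplit : b.repr.symm x
      = ∑ i with i.val < k, x i • b i + ∑ i with k ≤ i.val, x i • b i := by
    rw [← b.sum_repr_symm x, ← Finset.sum_filter_add_sum_filter_not _ fun i : Fin n => i.val < k]
    simp only [not_lt]
  have hsum : ∑ i, x i ^ 2 = ∑ i with i.val < k, x i ^ 2 + ∑ i with k ≤ i.val, x i ^ 2 := by
    rw [← Finset.sum_filter_add_sum_filter_not _ fun i : Fin n => i.val < k]
    simp only [not_lt]
  rw [hsplit, primitiveForm_eq
    (Submodule.sum_mem _ fun i hi => Submodule.smul_mem _ _ (hbH i (Finset.mem_filter.1 hi).2))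
    (Submodule.sum_mem _ fun i hi => Submodule.smul_mem _ _ (hbO i (Finset.mem_filter.1 hi).2)),
    hnorm, hnorm, standardQuartic, hsum]
  ring

theorem primitiveForm_orthogonal (H : Submodule ℝ (Euc n)) (x : Euc n) :
    primitiveForm Hᗮ x = primitiveForm H x := by
  simp only [primitiveForm, Submodule.orthogonal_orthogonal]
  ring

/-- Congruence does not see an orthogonal change of coordinates. -/
theorem congruentFun_of_comp {F F' G : Euc n → ℝ} (V : Euc n ≃ₗᵢ[ℝ] Euc n)
    (hV : ∀ x, F (V x) = F' x) : CongruentFun F G ↔ CongruentFun F' G := by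
  constructor
  · rintro ⟨U, hU⟩
    refine ⟨U.trans V.symm, ?_⟩
    simpa only [← hV, LinearIsometryEquiv.trans_apply, LinearIsometryEquiv.apply_symm_apply]
      using hU
  · rintro ⟨U, hU⟩
    exact ⟨U.trans V, by simpa only [LinearIsometryEquiv.trans_apply, hV] using hU⟩

theorem isPrimitive_iff : IsPrimitiveQuartic f ↔
    ∃ k : ℕ, k ≤ n / 2 ∧ CongruentFun (standardQuartic n k) (polyFun f) := by
  constructor
  · rintro ⟨H, hH⟩
    have hdim := H.finrank_add_finrank_orthogonal
    rw [finrank_euclideanSpace_fin] at hdim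
    rcases le_or_gt (Module.finrank ℝ H) (n / 2) with hk | hk
    · obtain ⟨V, hV⟩ := exists_isometry_primitiveForm H
      exact ⟨_, hk, (congruentFun_of_comp V hV).1 hH⟩
    · -- `h_{4,H}` is symmetric in `H` and its orthogonal complement
      obtain ⟨V, hV⟩ := exists_isometry_primitiveForm Hᗮ
      refine ⟨Module.finrank ℝ Hᗮ, ?_, (congruentFun_of_comp V hV).1 ?_⟩
      · omega
      · rwa [funext (primitiveForm_orthogonal H)]
  · rintro ⟨k, hk, hc⟩
    obtain ⟨H, hH⟩ : ∃ H : Submodule ℝ (Euc n), Module.finrank ℝ H = k := by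
      have hkn : k ≤ n := hk.trans (Nat.div_le_self n 2)
      refine ⟨Submodule.span ℝ (Set.range fun i : Fin k =>
        EuclideanSpace.basisFun (Fin n) ℝ (Fin.castLE hkn i)), ?_⟩
      rw [finrank_span_eq_card, Fintype.card_fin]
      exact ((EuclideanSpace.basisFun (Fin n) ℝ).orthonormal.linearIndependent).comp _
        (Fin.castLE_injective hkn)
    obtain ⟨V, hV⟩ := exists_isometry_primitiveForm H
    rw [hH] at hV
    exact ⟨H, (congruentFun_of_comp V hV).2 hc⟩

end Primitive

/-! ### The classification -/

theorem theorem1 (n : ℕ) (f : MvPolynomial (Fin n) ℝ) (hf : IsEikonalQuartic f) :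
    (IsIsoparametricQuartic f ∨ IsPrimitiveQuartic f) ∧
    (IsPrimitiveQuartic f ↔ ∃ k : ℕ, k ≤ n / 2 ∧ CongruentFun (standardQuartic n k) (polyFun f)) ∧
    (¬ IsPrimitiveQuartic f →
      ∃ p q ν : ℕ, 2 ≤ q ∧ 1 ≤ ν ∧ IsIsoparametricWith f (q - 1) ν ∧
        ∀ e : Euc n, ‖e‖ = 1 → (∀ y : Euc n, ‖y‖ = 1 → polyFun f y ≤ polyFun f e) →
          HasNormalForm f e p q ν) := by
  have main : ¬ IsPrimitiveQuartic f →
      ∃ p q ν : ℕ, 2 ≤ q ∧ 1 ≤ ν ∧ IsIsoparametricWith f (q - 1) ν ∧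
        ∀ e : Euc n, ‖e‖ = 1 → (∀ y : Euc n, ‖y‖ = 1 → polyFun f y ≤ polyFun f e) →
          HasNormalForm f e p q ν := by
    intro hp
    have hne := exists_isFocal_of_not_primitive hf hp
    obtain ⟨q, ν, hq, hν, hiso, hmult⟩ := polarForm_regular_isoparametric hf
      (isRegularForm_of_not_primitive hf hp) hne
    refine ⟨q - 1 + 2 * ν, q, ν, hq, hν, hiso, fun e he hmax => ?_⟩
    obtain ⟨h1, h2, h3⟩ := hmult e (isFocal_of_isMax hf hne he hmax)
    exact hasNormalForm hf (isFocal_of_isMax hf hne he hmax) h1 h2 h3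
  refine ⟨?_, isPrimitive_iff, main⟩
  by_cases hp : IsPrimitiveQuartic f
  · exact Or.inr hp
  · obtain ⟨_, q, ν, _, _, hiso, _⟩ := main hp
    exact Or.inl ⟨q - 1, ν, hiso⟩
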